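/- Setting. Let $S$ and $A$ be Borel spaces (Borel subsets of complete separable metric spaces) and let $K\subset S\times A$ be closed, with nonempty sections $A(s)=\{a:(s,a)\in K\}$. Let $Q(\cdot\mid s,a)$ be a stochastic kernel from $K$ to $S$, let $r,z:K\to\mathbb R$ be measurable, and let $Y$ be a random variable with values almost surely in a compact interval $[a,b]$. Write $(x)_-=\min\{x,0\}$ and $y(\eta)=\mathbb E[(Y-\eta)_-]$ for $\eta\in[a,b]$. A policy $\pi=(\pi_t)_{t\ge 0}$ is a sequence of stochastic kernels $\pi_t$ from the histories $H_t=K^t\times S$ to $A$ with $\pi_t(A(s_t)\mid h_t)=1$ for every $h_t=(s_0,a_0,\dots,s_t)\in H_t$; $\Pi$ is the set of policies. With an initial law $\nu\in\mathcal P(S)$ it determines the law $P^\pi_\nu$ of the process $(s_t,a_t)_{t\ge 0}$. For $\pi\in\Pi$, $\nu\in\mathcal P(S)$ put $$R(\pi,\nu)=\liminf_{T\to\infty}\frac1T\,\mathbb E^\pi_\nu\Big[\sum_{t=0}^{T-1}r(s_t,a_t)\Big],\qquad Z_\eta(\pi,\nu)=\liminf_{T\to\infty}\frac1T\,\mathbb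 E^\pi_\nu\Big[\sum_{t=0}^{T-1}(z(s_t,a_t)-\eta)_-\Big],$$ $$\Delta=\{(\pi,\nu)\in\Pi\times\mathcal P(S): R(\pi,\nu)>-\infty,\ Z_\eta(\pi,\nu)\ge y(\eta)\ \text{for all }\eta\in[a,b]\}.$$ Let $w=1-r$ on $K$ and $\hat w(s)=1-\sup_{a\in A(s)}r(s,a)$ on $S$. Let $\mathcal M_w(K)$ be the space of signed measures $\mu$ on $K$ with $\int w\,d|\mu|<\infty$. Let $\mathcal F_w(K)$ be the space of measurable $f:K\to\mathbb R$ with $\sup_K|f|/w<\infty$, and $\mathcal F_{\hat w}(S)$ the analogous space on $S$ with weight $\hat w$. Let $\mathcal M([a,b])$ be the space of finite signed Borel measures on $[a,b]$. Write $\langle\mu,f\rangle=\int f\,d\mu$. Assumptions. 1. $\Delta\neq\emptyset$. 2. $r\le 0$, and $\{k\in K: r(k)\ge-\epsilon\}$ is compact for every $\epsilon\ge 0$. 3. $z$ is bounded and upper semicontinuous on $K$. 4. $Q$ is weakly continuous: $(s,a)\mapsto\int g(\xi)\,Q(d\xi\mid s,a)$ is continuous on $K$ for every bounded continuous $g:S\to\mathbb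 R$. 5. $(z-\eta)_-\in\mathcal F_w(K)$ for all $\eta\in[a,b]$. 6. The function $(s,a)\mapsto\int\hat w(\xi)\,Q(d\xi\mid s,a)$ is finite and belongs to $\mathcal F_w(K)$. Linear programs. For a signed measure $\mu$ on $K$ with marginal $\hat\mu$ on $S$ let $[L_0\mu](B)=\hat\mu(B)-\int_K Q(B\mid s,a)\,\mu(d(s,a))$ for Borel $B\subset S$, and $[L_1\mu](\eta)=\langle\mu,(z-\eta)_-\rangle$ for $\eta\in[a,b]$. Let $[L_0^*h](s,a)=h(s)-\int_S h(\xi)\,Q(d\xi\mid s,a)$ and $[L_1^*\Lambda](s,a)=\int_a^b(z(s,a)-\eta)_-\,\Lambda(d\eta)$. The primal problem is $$\max\ \langle\mu,r\rangle\quad\text{s.t.}\quad L_0\mu=0,\ \ \langle\mu,1\rangle=1,\ \ L_1\mu\ge y\ \text{in } C([a,b]),\ \ \mu\in\mathcal M_w(K),\ \mu\ge 0,$$ and the dual problem is $$\inf\ \beta-\langle\Lambda,y\rangle\quad\text{s.t.}\quad r+L_0^*h-\beta\,1+L_1^*\Lambda\le 0\ \text{on }K,\ \ (h,\beta,\Lambda)\in\mathcal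 F_{\hat w}(S)\times\mathbb R\times\mathcal M([a,b]),\ \Lambda\ge 0.$$ Theorem. There is no duality gap, and the common value is that of the dominance-constrained Markov decision process: there is a real number $\rho^*$ such that $$\rho^*=\max\{R(\pi,\nu):(\pi,\nu)\in\Delta\}=\max\{\langle\mu,r\rangle:\mu\ \text{feasible for the primal problem}\}=\inf\{\beta-\langle\Lambda,y\rangle:(h,\beta,\Lambda)\ \text{feasible for the dual problem}\},$$ where both maxima are attained. -/

import Mathlib

open MeasureTheory ProbabilityTheory Filter Topology
open scoped ENNReal BoundedContinuousFunction

namespace DominanceMDP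

noncomputable section

/-- `(x)₋ = min {x, 0}` (a nonpositive number). -/
def minusPart (x : ℝ) : ℝ := min x 0

/-- Extended-real expectation `E[f⁺] - E[f⁻]`; for bounded above `f` under a probability measure it
is the usual expectation, with value in `[-∞, ∞)`. -/
def extExpectation {Ω : Type*} [MeasurableSpace Ω] (P : Measure Ω) (f : Ω → ℝ) : EReal :=
  ((∫⁻ ω, ENNReal.ofReal (f ω) ∂P : ℝ≥0∞) : EReal)
    - ((∫⁻ ω, ENNReal.ofReal (-f ω) ∂P : ℝ≥0∞) : EReal)

/-- The pairing `⟨μ, f⟩ = ∫ f dμ` of a signed measure and a real function. -/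
def pairing {X : Type*} [MeasurableSpace X] (μ : SignedMeasure X) (f : X → ℝ) : ℝ :=
  ∫ᵛ x, f x ∂<•μ

/-- The weighted space of signed measures `μ` with `∫ w d|μ| < ∞`. -/
def weightedMeasures {X : Type*} [MeasurableSpace X] (w : X → ℝ) : Set (SignedMeasure X) :=
  {μ | ∫⁻ x, ENNReal.ofReal (w x) ∂μ.totalVariation < ∞}

/-- The weighted space of measurable functions `h` with `sup |h| / w < ∞`. -/
def weightedFunctions {X : Type*} [MeasurableSpace X] (w : X → ℝ) : Set (X → ℝ) :=
  {h | Measurable h ∧ BddAbove (Set.range fun x => |h x| / w x)}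

/-- A Markov decision process on `S`, `A`: the closed set `K` of feasible state-action pairs
(with `A(s) = {a | (s, a) ∈ K}` nonempty), the transition law `Q` and the reward `r`. -/
structure MDP (S A : Type*) [TopologicalSpace S] [MeasurableSpace S]
    [TopologicalSpace A] [MeasurableSpace A] where
  K : Set (S × A)
  isClosed_K : IsClosed K
  exists_action : ∀ s, ∃ a, (s, a) ∈ K
  Q : Kernel K S
  isMarkovKernel_Q : IsMarkovKernel Q
  r : K → ℝ
  measurable_r : Measurable r

variable {S A : Type*} [TopologicalSpace S] [MeasurableSpace S]
  [TopologicalSpace A] [MeasurableSpace A]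

namespace MDP

instance (M : MDP S A) : IsMarkovKernel M.Q := M.isMarkovKernel_Q

/-- The weight `w = 1 - r` on `K`. -/
def w (M : MDP S A) (k : M.K) : ℝ := 1 - M.r k

/-- The weight `ŵ(s) = 1 - sup_{a ∈ A(s)} r(s, a)` on `S`. -/
def wHat (M : MDP S A) (s : S) : ℝ := 1 - ⨆ a : {a : A // (s, a) ∈ M.K}, M.r ⟨(s, a.1), a.2⟩

/-- The histories `H_t = K^t × S`. -/
abbrev Hist (M : MDP S A) (t : ℕ) : Type _ := (Fin t → M.K) × S

/-- A history-dependent randomized policy that respects the constraints `K`. -/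
structure Policy (M : MDP S A) where
  kernel : ∀ t : ℕ, Kernel (M.Hist t) A
  isMarkovKernel : ∀ t, IsMarkovKernel (kernel t)
  feasible : ∀ t (h : M.Hist t), kernel t h {a | (h.2, a) ∈ M.K} = 1

instance (M : MDP S A) (π : M.Policy) (t : ℕ) : IsMarkovKernel (π.kernel t) := π.isMarkovKernel t

/-- The transition law acting on signed measures, `μ ↦ ∫ Q(· | k) μ(dk)`. -/
def pushQ (M : MDP S A) (μ : SignedMeasure M.K) : SignedMeasure S :=
  (M.Q ∘ₘ μ.toJordanDecomposition.posPart).toSignedMeasure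
    - (M.Q ∘ₘ μ.toJordanDecomposition.negPart).toSignedMeasure

/-- `L₀μ = μ̂ - ∫ Q(· | k) μ(dk)`, where `μ̂` is the marginal of `μ` on `S`. -/
def L0 (M : MDP S A) (μ : SignedMeasure M.K) : SignedMeasure S :=
  μ.map (fun k : M.K => k.1.1) - M.pushQ μ

/-- `[L₁μ](η) = ⟨μ, (z - η)₋⟩`. -/
def L1 (M : MDP S A) (z : M.K → ℝ) (a b : ℝ) (μ : SignedMeasure M.K) : Set.Icc a b → ℝ :=
  fun η => pairing μ fun k => minusPart (z k - η)

/-- `[L₀*h](s, a) = h(s) - ∫ h(ξ) Q(dξ | s, a)`. -/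
def L0Adj (M : MDP S A) (h : S → ℝ) : M.K → ℝ :=
  fun k => h k.1.1 - ∫ ξ, h ξ ∂(M.Q k)

/-- `[L₁*Λ](s, a) = ∫ (z(s, a) - η)₋ Λ(dη)`. -/
def L1Adj (M : MDP S A) (z : M.K → ℝ) (a b : ℝ) (Λ : SignedMeasure (Set.Icc a b)) : M.K → ℝ :=
  fun k => pairing Λ fun η => minusPart (z k - η)

/-- The feasible set of the primal linear program. -/
def primalFeasible (M : MDP S A) (z : M.K → ℝ) (a b : ℝ) (y : Set.Icc a b → ℝ) :
    Set (SignedMeasure M.K) :=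
  {μ | M.L0 μ = 0 ∧ pairing μ (fun _ => 1) = 1 ∧ y ≤ M.L1 z a b μ ∧
    μ ∈ weightedMeasures M.w ∧ 0 ≤ μ}

/-- The feasible set of the dual linear program. -/
def dualFeasible (M : MDP S A) (z : M.K → ℝ) (a b : ℝ) :
    Set ((S → ℝ) × ℝ × SignedMeasure (Set.Icc a b)) :=
  {d | (∀ k : M.K, M.r k + M.L0Adj d.1 k - d.2.1 + M.L1Adj z a b d.2.2 k ≤ 0) ∧
    d.1 ∈ weightedFunctions M.wHat ∧ 0 ≤ d.2.2}

/-- `y(η) = E[(Y - η)₋]` for `η ∈ [a, b]`. -/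
def _root_.DominanceMDP.benchmark {Ω : Type*} [MeasurableSpace Ω] (P : Measure Ω) (Y : Ω → ℝ)
    (a b : ℝ) : Set.Icc a b → ℝ :=
  fun η => ∫ ω, minusPart (Y ω - η) ∂P

section Dynamics

variable [BorelSpace S] [BorelSpace A] [SecondCountableTopologyEither S A]

lemma measurableSet_K (M : MDP S A) : MeasurableSet M.K := M.isClosed_K.measurableSet

/-- Given the history `h_t = (s_0, a_0, …, s_t)`, the law on `K` of `(s_t, a_t)`. -/
def stateAction (M : MDP S A) (π : M.Policy) (t : ℕ) : Kernel (M.Hist t) M.K :=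
  (Kernel.deterministic (Prod.snd : M.Hist t → S) measurable_snd ×ₖ π.kernel t).comapRight
    (MeasurableEmbedding.subtype_coe M.measurableSet_K)

instance (M : MDP S A) (π : M.Policy) (t : ℕ) : IsMarkovKernel (M.stateAction π t) := by
  apply Kernel.IsMarkovKernel.comapRight
  intro h
  rw [Subtype.range_coe_subtype, Kernel.prod_apply, Kernel.deterministic_apply]
  have hm : MeasurableSet {x : S × A | x ∈ M.K} := M.measurableSet_K
  rw [Measure.prod_apply hm, lintegral_dirac' _ (measurable_measure_prodMk_left hm)]
  exact π.feasible t h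

/-- The law of `(s_{t+1}, a_{t+1})` given `(s_0, a_0), …, (s_t, a_t)`: first
`s_{t+1} ∼ Q(· | s_t, a_t)`, then `a_{t+1} ∼ π_{t+1}(· | h_{t+1})`. -/
def step (M : MDP S A) (π : M.Policy) (t : ℕ) :
    Kernel ((_i : Finset.Iic t) → M.K) M.K :=
  M.stateAction π (t + 1) ∘ₖ
    (Kernel.deterministic
        (fun (x : (_i : Finset.Iic t) → M.K) (i : Fin (t + 1)) =>
          x ⟨i.1, Finset.mem_Iic.2 (Nat.lt_succ_iff.1 i.2)⟩)
        (measurable_pi_lambda _ fun _ => measurable_pi_apply _) ×ₖ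
      M.Q.comap (fun x : (_i : Finset.Iic t) → M.K => x ⟨t, Finset.mem_Iic.2 le_rfl⟩)
        (measurable_pi_apply _))

instance (M : MDP S A) (π : M.Policy) (t : ℕ) : IsMarkovKernel (M.step π t) := by
  unfold step; infer_instance

/-- The law of `(s_0, a_0)` when `s_0 ∼ ν`. -/
def init (M : MDP S A) (π : M.Policy) (ν : ProbabilityMeasure S) : Measure M.K :=
  M.stateAction π 0 ∘ₘ
    (ν : Measure S).map (fun s : S => ((fun i => i.elim0 : Fin 0 → M.K), s))

/-- The measure `P_ν^π` on trajectories `((s_0, a_0), (s_1, a_1), …) ∈ K^ℕ`. -/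
def trajLaw (M : MDP S A) (π : M.Policy) (ν : ProbabilityMeasure S) : Measure (ℕ → M.K) :=
  Kernel.trajMeasure (X := fun _ => M.K) (M.init π ν) (M.step π)

/-- `liminf_T (1/T) E_ν^π [∑_{t < T} f(s_t, a_t)]`. -/
def average (M : MDP S A) (f : M.K → ℝ) (π : M.Policy) (ν : ProbabilityMeasure S) : EReal :=
  liminf (fun T : ℕ => (((1 : ℝ) / (T : ℝ) : ℝ) : EReal) *
    extExpectation (M.trajLaw π ν) fun x => ∑ t ∈ Finset.range T, f (x t)) atTop

/-- The long-run expected average reward `R(π, ν)`. -/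
def R (M : MDP S A) (π : M.Policy) (ν : ProbabilityMeasure S) : EReal := M.average M.r π ν

/-- The long-run expected average shortfall `Z_η(π, ν)` in `z` at level `η`. -/
def Z (M : MDP S A) (z : M.K → ℝ) (η : ℝ) (π : M.Policy) (ν : ProbabilityMeasure S) : EReal :=
  M.average (fun k => minusPart (z k - η)) π ν

/-- The feasible set `Δ` of the dominance-constrained MDP. -/
def Feasible (M : MDP S A) (z : M.K → ℝ) (a b : ℝ) (y : Set.Icc a b → ℝ) :
    Set (M.Policy × ProbabilityMeasure S) :=
  {p | ⊥ < M.R p.1 p.2 ∧ ∀ η : Set.Icc a b, (y η : EReal) ≤ M.Z z η p.1 p.2}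

end Dynamics

end MDP

end

/-! Checks of the definitions. -/

lemma MDP.pushQ_apply {S A : Type*} [TopologicalSpace S] [MeasurableSpace S]
    [TopologicalSpace A] [MeasurableSpace A] (M : MDP S A) (μ : SignedMeasure M.K)
    {B : Set S} (hB : MeasurableSet B) :
    M.pushQ μ B = pairing μ fun k => (M.Q k B).toReal := by
  have hint : ∀ m : Measure M.K, IsFiniteMeasure m →
      Integrable (fun k => (M.Q k B).toReal) m := fun m _ =>
    Integrable.of_bound (M.Q.measurable_coe hB).ennreal_toReal.aestronglyMeasurable 1
      (ae_of_all _ fun k => by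
        rw [Real.norm_of_nonneg ENNReal.toReal_nonneg]
        exact ENNReal.toReal_le_of_le_ofReal zero_le_one (by simpa using prob_le_one))
  have happ : ∀ m : Measure M.K, IsFiniteMeasure m →
      (M.Q ∘ₘ m).real B = ∫ k, (M.Q k B).toReal ∂m := fun m _ => by
    rw [measureReal_def, Measure.bind_apply hB M.Q.aemeasurable,
      integral_toReal (M.Q.measurable_coe hB).aemeasurable
        (ae_of_all _ fun k => measure_lt_top _ _)]
  unfold MDP.pushQ pairing
  rw [Measure.toSignedMeasure_sub_apply hB, happ _ inferInstance, happ _ inferInstance]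
  conv_rhs => rw [← μ.toSignedMeasure_toJordanDecomposition]
  rw [JordanDecomposition.toSignedMeasure, VectorMeasure.integral_sub_vectorMeasure,
    VectorMeasure.integral_toSignedMeasure, VectorMeasure.integral_toSignedMeasure]
  · simpa [VectorMeasure.Integrable] using hint _ inferInstance
  · simpa [VectorMeasure.Integrable] using hint _ inferInstance

/-- `[L₀μ](B) = μ̂(B) - ∫ Q(B | s, a) μ(d(s, a))`. -/
lemma MDP.L0_apply {S A : Type*} [TopologicalSpace S] [MeasurableSpace S]
    [TopologicalSpace A] [MeasurableSpace A] (M : MDP S A) (μ : SignedMeasure M.K)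
    {B : Set S} (hB : MeasurableSet B) :
    M.L0 μ B = μ {k | k.1.1 ∈ B} - pairing μ fun k => (M.Q k B).toReal := by
  rw [← M.pushQ_apply μ hB, MDP.L0, _root_.sub_apply,
    VectorMeasure.map_apply μ (f := fun k : M.K => k.1.1)
      (measurable_fst.comp measurable_subtype_coe) hB]
  rfl

/-- `L₁μ` is an element of `C([a, b])`. -/
lemma MDP.continuous_L1 {S A : Type*} [TopologicalSpace S] [MeasurableSpace S]
    [TopologicalSpace A] [MeasurableSpace A] (M : MDP S A) {z : M.K → ℝ} (hz : Measurable z)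
    {C : ℝ} (hC : ∀ k, |z k| ≤ C) (a b : ℝ) (μ : SignedMeasure M.K) :
    Continuous (M.L1 z a b μ) := by
  unfold MDP.L1 pairing
  have : IsFiniteMeasure μ.variation := by
    rw [← SignedMeasure.totalVariation_eq_variation]; infer_instance
  refine VectorMeasure.continuous_of_dominated (bound := fun _ => C + (|a| + |b|)) ?_ ?_ ?_ ?_
  · intro η
    exact ((hz.sub_const _).min measurable_const).aestronglyMeasurable
  · intro η
    refine ae_of_all _ fun k => ?_
    have h1 := abs_le.1 (hC k)
    have h2 : |(η : ℝ)| ≤ |a| + |b| :=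
      (abs_le_max_abs_abs η.2.1 η.2.2).trans (max_le_add_of_nonneg (abs_nonneg _) (abs_nonneg _))
    have h3 := abs_le.1 h2
    have h4 : 0 ≤ C := (abs_nonneg _).trans (hC k)
    rw [Real.norm_eq_abs, minusPart, abs_le]
    constructor
    · apply le_min <;> linarith [abs_nonneg a, abs_nonneg b]
    · exact (min_le_right _ _).trans (by positivity)
  · exact integrable_const _
  · refine ae_of_all _ fun k => ?_
    unfold minusPart
    fun_prop

/-- `y` is an element of `C([a, b])`. -/
lemma continuous_benchmark {Ω : Type*} [MeasurableSpace Ω] (P : Measure Ω)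
    [IsProbabilityMeasure P] (Y : Ω → ℝ) (a b : ℝ) (hY : AEMeasurable Y P)
    (hYab : ∀ᵐ ω ∂P, Y ω ∈ Set.Icc a b) : Continuous (benchmark P Y a b) := by
  unfold benchmark
  refine continuous_of_dominated (bound := fun _ => b - a) ?_ ?_ ?_ ?_
  · intro η
    exact ((hY.sub_const _).min aemeasurable_const).aestronglyMeasurable
  · intro η
    filter_upwards [hYab] with ω hω
    have h1 := η.2.1
    have h2 := η.2.2
    rw [Real.norm_eq_abs, minusPart, abs_le]
    constructor
    · apply le_min <;> linarith [hω.1]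
    · exact (min_le_right _ _).trans (by linarith)
  · exact integrable_const _
  · refine ae_of_all _ fun ω => ?_
    unfold minusPart
    fun_prop

end DominanceMDP

set_option linter.unusedSectionVars false

/-! All three values are compared with a moment problem: maximize `∫ r dm` over probability measures
`m` on `K` of finite cost that are invariant (state marginal equal to `Q ∘ₘ m`) and satisfy `y η ≤ ∫
(z - η)₋ dm` for every `η`. Tested against bounded continuous `h`, invariance becomes a family of
inequalities, so every constraint reads `0 ≤ ∫ g dm` with `g` bounded and upper semicontinuous
(`constraintFn`).

Compact level sets of `r` make the laws of bounded cost compact in the weak topology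
(`isCompact_cost_le`), so an optimal law exists. For `c` above its value, compactness shows that
finitely many constraints already exclude the value `c`, with a uniform margin. Finite-dimensional
separation then gives multipliers, and testing on Dirac masses makes the inequality pointwise
(`exists_multipliers`): this is a dual feasible point of value `c`. Weak duality follows by
integrating the dual constraint.

For the control problem, weak limits of the occupation measures of a feasible policy are feasible
laws of at least as large a reward (`exists_momentFeasible_of_mem_Feasible`). Conversely,
disintegrating an invariant law gives a stationary policy under which every `(s_t, a_t)` has that
law (`exists_policy_marginalLaw_eq`). -/

namespace DominanceMDP

/-! ### Separation from the positive orthant in finite dimension. -/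

section Separation

/-- A convex set in `ℝ^ι` that avoids the open positive orthant is separated from it by a nonzero
nonnegative functional. -/
lemma exists_nonneg_separating {ι : Type*} [Fintype ι] {D : Set (ι → ℝ)}
    (hD : Convex ℝ D) (hne : D.Nonempty) (h : ∀ v ∈ D, ∃ i, v i ≤ 0) :
    ∃ c : ι → ℝ, (∀ i, 0 ≤ c i) ∧ (∃ i, c i ≠ 0) ∧ ∀ v ∈ D, ∑ i, c i * v i ≤ 0 := by
  classical
  let s : Set (ι → ℝ) := Set.univ.pi fun _ => Set.Ioi 0
  have hs1 : Convex ℝ s := convex_pi fun _ _ => convex_Ioi 0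
  have hs2 : IsOpen s := isOpen_set_pi Set.finite_univ fun _ _ => isOpen_Ioi
  have hdisj : Disjoint s D := by
    rw [Set.disjoint_left]
    intro v hv hvD
    obtain ⟨i, hi⟩ := h v hvD
    exact absurd (hv i trivial) (not_lt.2 hi)
  obtain ⟨f, u, hfs, hfD⟩ := geometric_hahn_banach_open hs1 hs2 hD hdisj
  -- `s` is a cone on which `f` is bounded above by `u`; a positive value could be scaled past `u`.
  have hscale : ∀ v ∈ s, f v ≤ 0 := by
    intro v hv
    by_contra! hpos
    obtain ⟨n, hn⟩ := exists_nat_gt (u / f v)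
    have h1 : f (((n : ℝ) + 1) • v) < u := hfs _ fun i _ => by
      have : 0 < v i := hv i trivial
      change 0 < ((n : ℝ) + 1) * v i
      positivity
    rw [map_smul, smul_eq_mul] at h1
    rw [div_lt_iff₀ hpos] at hn
    nlinarith
  have hone : (fun _ : ι => (1 : ℝ)) ∈ s := fun i _ => one_pos (α := ℝ)
  -- Shrinking a point of the cone towards `0` brings `f` arbitrarily close to `0`, still below `u`.
  have hu : 0 ≤ u := by
    by_contra! hneg
    have h0 := hscale _ hone
    obtain ⟨n, hn⟩ := exists_nat_gt (f (fun _ : ι => (1 : ℝ)) / u)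
    have hn0 : (0 : ℝ) < (n : ℝ) + 1 := by positivity
    have h1 : f (((n : ℝ) + 1)⁻¹ • (fun _ : ι => (1 : ℝ))) < u := hfs _ fun i _ => by
      change 0 < ((n : ℝ) + 1)⁻¹ * 1
      positivity
    rw [map_smul, smul_eq_mul, inv_mul_lt_iff₀ hn0] at h1
    rw [div_lt_iff_of_neg hneg] at hn
    nlinarith
  have hbasis : ∀ i, f (Pi.single i 1) ≤ 0 := by
    intro i
    by_contra! hpos
    obtain ⟨n, hn⟩ := exists_nat_gt (-f (fun _ : ι => (1 : ℝ)) / f (Pi.single i 1))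
    have h1 := hscale ((n : ℝ) • Pi.single i 1 + fun _ : ι => (1 : ℝ)) fun j _ => by
      change 0 < (n : ℝ) * (Pi.single i (1 : ℝ) : ι → ℝ) j + 1
      have : 0 ≤ (Pi.single i (1 : ℝ) : ι → ℝ) j := by
        rw [Pi.single_apply]; split_ifs <;> norm_num
      positivity
    rw [map_add, map_smul, smul_eq_mul] at h1
    rw [div_lt_iff₀ hpos] at hn
    linarith
  have hsum : ∀ v, f v = ∑ i, v i * f (Pi.single i 1) := by
    intro v
    conv_lhs => rw [pi_eq_sum_univ' v]
    rw [map_sum]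
    simp only [map_smul, smul_eq_mul]
  refine ⟨fun i => -f (Pi.single i 1), fun i => neg_nonneg.2 (hbasis i), ?_, fun v hv => ?_⟩
  -- If all coefficients vanish then `f = 0`, against the strict inequality `f 1 < u ≤ f v`.
  · by_contra! hall
    obtain ⟨v, hv⟩ := hne
    have h1 := hfs _ hone
    have h2 := hfD v hv
    have hz : ∀ i, f (Pi.single i 1) = 0 := fun i => neg_eq_zero.1 (hall i)
    rw [hsum] at h1 h2
    simp only [hz, mul_zero, Finset.sum_const_zero] at h1 h2
    linarith
  · have := hfD v hv
    rw [hsum] at this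
    simp only [neg_mul, Finset.sum_neg_distrib]
    have h2 : ∑ i, f (Pi.single i 1) * v i = ∑ i, v i * f (Pi.single i 1) :=
      Finset.sum_congr rfl fun i _ => mul_comm _ _
    linarith

end Separation

noncomputable section

/-! ### Weak compactness and strong duality for the moment problem. -/

section Semicontinuity

lemma upperSemicontinuous_of_isCompact_levels {X : Type*} [TopologicalSpace X] [T2Space X]
    {r : X → ℝ} (hr : ∀ x, r x ≤ 0)
    (hrc : ∀ ε : ℝ, 0 ≤ ε → IsCompact {x | -ε ≤ r x}) : UpperSemicontinuous r := by
  rw [upperSemicontinuous_iff_isClosed_preimage]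
  intro c
  rcases le_or_gt c 0 with hc | hc
  · have := (hrc (-c) (by linarith)).isClosed
    rw [neg_neg] at this
    exact this
  · convert isClosed_empty
    ext x
    simpa using (hr x).trans_lt hc

variable {X : Type*} [MeasurableSpace X]

/-- `∫ f⁻ dμ ∈ [0, ∞]`; for `f ≤ 0` this is `-∫ f dμ`. -/
def cost (f : X → ℝ) (μ : Measure X) : ℝ≥0∞ := ∫⁻ x, ENNReal.ofReal (-f x) ∂μ

lemma integrable_of_cost_lt_top {f : X → ℝ} (hf : Measurable f) (h0 : ∀ x, f x ≤ 0)
    {μ : Measure X} (h : cost f μ < ∞) : Integrable f μ := by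
  have h1 : HasFiniteIntegral (fun x => -f x) μ := by
    rw [hasFiniteIntegral_iff_ofReal (ae_of_all _ fun x => neg_nonneg.2 (h0 x))]
    exact h
  simpa using (show Integrable (fun x => -f x) μ from ⟨hf.neg.aestronglyMeasurable, h1⟩).neg

lemma integral_eq_neg_cost {f : X → ℝ} (hf : Measurable f) (h0 : ∀ x, f x ≤ 0)
    (μ : Measure X) : ∫ x, f x ∂μ = -(cost f μ).toReal := by
  have h1 : 0 ≤ᵐ[μ] fun x => -f x := ae_of_all _ fun x => neg_nonneg.2 (h0 x)
  have := integral_eq_lintegral_of_nonneg_ae h1 hf.neg.aestronglyMeasurable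
  rw [integral_neg] at this
  unfold cost
  linarith

lemma cost_lt_top_of_integrable {f : X → ℝ} {μ : Measure X} (h : Integrable f μ) :
    cost f μ < ∞ :=
  h.neg.lintegral_lt_top

lemma integrable_of_usc_bounded [TopologicalSpace X] [BorelSpace X] {g : X → ℝ} (hg : UpperSemicontinuous g) {B : ℝ}
    (hB : ∀ x, |g x| ≤ B) (μ : Measure X) [IsFiniteMeasure μ] : Integrable g μ :=
  Integrable.of_bound hg.measurable.aestronglyMeasurable B (ae_of_all _ hB)

variable [TopologicalSpace X] [TopologicalSpace.MetrizableSpace X] [SecondCountableTopology X]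
  [BorelSpace X]

/-- Layer-cake formula: the sets `{s < -f}` are open, so their masses are lower semicontinuous by
the portmanteau theorem, and Fatou's lemma passes this to the integral over `s`. Sequences suffice
because the space of laws is metrizable. -/
lemma lowerSemicontinuous_cost {f : X → ℝ} (hf : UpperSemicontinuous f) (h0 : ∀ x, f x ≤ 0) :
    LowerSemicontinuous fun μ : ProbabilityMeasure X => cost f (μ : Measure X) := by
  let _ := TopologicalSpace.metrizableSpaceMetric X
  rw [lowerSemicontinuous_iff_isClosed_preimage]
  intro t
  refine IsSeqClosed.isClosed fun μs μ hμs hμ => ?_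
  have hopen : ∀ G, IsOpen G → (μ : Measure X) G ≤ atTop.liminf fun n => (μs n : Measure X) G :=
    fun G hG => ProbabilityMeasure.le_liminf_measure_open_of_tendsto hμ hG
  have hnn : ∀ ν : Measure X, 0 ≤ᵐ[ν] fun x => -f x := fun ν =>
    ae_of_all _ fun x => neg_nonneg.2 (h0 x)
  have hle : cost f (μ : Measure X) ≤ atTop.liminf fun n => cost f (μs n : Measure X) := by
    unfold cost
    simp_rw [lintegral_eq_lintegral_meas_lt _ (hnn _) hf.measurable.neg.aemeasurable]
    refine le_trans (lintegral_mono fun s => hopen _ ?_) (lintegral_liminf_le fun n => ?_)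
    · have : {x | s < -f x} = f ⁻¹' Set.Iio (-s) := by ext x; simp [lt_neg]
      rw [this]
      exact hf.isOpen_preimage (-s)
    · refine Antitone.measurable fun s s' hs => measure_mono fun x hx => ?_
      exact lt_of_le_of_lt hs hx
  exact hle.trans (liminf_le_of_frequently_le' (Frequently.of_forall hμs))

/-- Since `g - B ≤ 0`, the integral is `B` minus a finite, lower semicontinuous cost. -/
lemma upperSemicontinuous_integral {g : X → ℝ} (hg : UpperSemicontinuous g) {B : ℝ}
    (hB : ∀ x, |g x| ≤ B) :
    UpperSemicontinuous fun μ : ProbabilityMeasure X => ∫ x, g x ∂(μ : Measure X) := by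
  have h0 : ∀ x, g x - B ≤ 0 := fun x => by linarith [(abs_le.1 (hB x)).2]
  have husc : UpperSemicontinuous fun x => g x - B := by
    simpa [sub_eq_add_neg] using hg.add (continuous_const (y := -B)).upperSemicontinuous
  have hint : ∀ μ : ProbabilityMeasure X, Integrable g (μ : Measure X) := fun μ =>
    Integrable.of_bound hg.measurable.aestronglyMeasurable B (ae_of_all _ hB)
  have heq : ∀ μ : ProbabilityMeasure X, ∫ x, g x ∂(μ : Measure X)
      = B - (cost (fun x => g x - B) (μ : Measure X)).toReal := by
    intro μ
    have := integral_eq_neg_cost husc.measurable h0 (μ : Measure X)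
    rw [integral_sub (hint μ) (integrable_const _)] at this
    simp only [integral_const, probReal_univ, smul_eq_mul, one_mul] at this
    linarith
  have hfin : ∀ μ : ProbabilityMeasure X, cost (fun x => g x - B) (μ : Measure X) < ∞ :=
    fun μ => cost_lt_top_of_integrable ((hint μ).sub (integrable_const _))
  intro μ q hq
  simp only [heq] at hq ⊢
  rcases lt_or_ge (B - q) 0 with hneg | hpos
  · exact Eventually.of_forall fun ν => by
      have : 0 ≤ (cost (fun x => g x - B) (ν : Measure X)).toReal := ENNReal.toReal_nonneg
      linarith
  · have h1 : ENNReal.ofReal (B - q) < cost (fun x => g x - B) (μ : Measure X) :=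
      (ENNReal.ofReal_lt_iff_lt_toReal hpos (hfin μ).ne).2 (by linarith)
    filter_upwards [lowerSemicontinuous_cost husc h0 μ _ h1] with ν hν
    have := (ENNReal.ofReal_lt_iff_lt_toReal hpos (hfin ν).ne).1 hν
    linarith

/-- Prokhorov's theorem: by Markov's inequality a law of cost at most `C` puts mass at most `C / (n
+ 1)` outside the compact set `{-(n + 1) ≤ r}`. Closedness is lower semicontinuity of the cost. -/
lemma isCompact_cost_le {r : X → ℝ} (hr : ∀ x, r x ≤ 0)
    (hrc : ∀ ε : ℝ, 0 ≤ ε → IsCompact {x | -ε ≤ r x}) {C : ℝ≥0∞} (hC : C ≠ ∞) :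
    IsCompact {μ : ProbabilityMeasure X | cost r (μ : Measure X) ≤ C} := by
  have husc := upperSemicontinuous_of_isCompact_levels hr hrc
  lift C to NNReal using hC
  have hu : Tendsto (fun n : ℕ => C / ((n : NNReal) + 1)) atTop (𝓝 0) := by
    rw [← NNReal.tendsto_coe]
    push_cast
    simpa [div_eq_mul_inv] using
      (tendsto_one_div_add_atTop_nhds_zero_nat (𝕜 := ℝ)).const_mul (C : ℝ)
  have hcpt := isCompact_setOfPred_probabilityMeasure_mass_eq_compl_isCompact_le (E := X) hu
    (fun n => hrc ((n : ℝ) + 1) (by positivity)) (Or.inl inferInstance)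
  refine hcpt.of_isClosed_subset
    ((lowerSemicontinuous_iff_isClosed_preimage.1 (lowerSemicontinuous_cost husc hr)) C) ?_
  intro μ hμ n
  have hμ' : cost r (μ : Measure X) ≤ C := hμ
  rw [← ENNReal.coe_le_coe, ProbabilityMeasure.ennreal_coeFn_eq_coeFn_toMeasure]
  have hn : ((n : NNReal) + 1 : NNReal) ≠ 0 := by positivity
  rw [ENNReal.coe_div hn, ENNReal.le_div_iff_mul_le (Or.inl (by exact_mod_cast hn))
    (Or.inl ENNReal.coe_ne_top), mul_comm]
  refine le_trans ?_ hμ'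
  refine le_trans ?_ (mul_meas_ge_le_lintegral (μ := (μ : Measure X))
    (husc.measurable.neg.ennreal_ofReal) (((n : NNReal) + 1 : NNReal) : ℝ≥0∞))
  gcongr
  intro x hx
  have hx' : r x < -((n : ℝ) + 1) := by simpa using hx
  change _ ≤ ENNReal.ofReal (-r x)
  rw [← ENNReal.ofReal_coe_nnreal]
  apply ENNReal.ofReal_le_ofReal
  push_cast
  linarith

/-- `μ` has finite cost `∫ r dμ > -∞` and satisfies all the moment constraints `∫ gᵢ dμ ≥ 0`. -/
def MomentFeasible {ι : Type*} (r : X → ℝ) (g : ι → X → ℝ) (μ : ProbabilityMeasure X) : Prop :=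
  cost r (μ : Measure X) < ∞ ∧ ∀ i, 0 ≤ ∫ x, g i x ∂(μ : Measure X)

lemma exists_momentFeasible_min_cost {ι : Type*} {r : X → ℝ} {g : ι → X → ℝ}
    (hr : ∀ x, r x ≤ 0) (hrc : ∀ ε : ℝ, 0 ≤ ε → IsCompact {x | -ε ≤ r x})
    (hg : ∀ i, UpperSemicontinuous (g i)) (hgb : ∀ i, ∃ B, ∀ x, |g i x| ≤ B)
    (hne : ∃ μ, MomentFeasible r g μ) :
    ∃ μ, MomentFeasible r g μ ∧
      ∀ ν, MomentFeasible r g ν → cost r (μ : Measure X) ≤ cost r (ν : Measure X) := by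
  obtain ⟨μ₀, h₀, hg₀⟩ := hne
  have husc := upperSemicontinuous_of_isCompact_levels hr hrc
  have hclosed : IsClosed {μ : ProbabilityMeasure X | ∀ i, 0 ≤ ∫ x, g i x ∂(μ : Measure X)} := by
    rw [Set.ofPred_forall]
    refine isClosed_iInter fun i => ?_
    obtain ⟨B, hB⟩ := hgb i
    exact (upperSemicontinuous_iff_isClosed_preimage.1 (upperSemicontinuous_integral (hg i) hB)) 0
  have hcpt := (isCompact_cost_le hr hrc h₀.ne).inter_right hclosed
  have hne' : ({μ : ProbabilityMeasure X | cost r (μ : Measure X) ≤ cost r (μ₀ : Measure X)} ∩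
      {μ | ∀ i, 0 ≤ ∫ x, g i x ∂(μ : Measure X)}).Nonempty := ⟨μ₀, le_refl (cost r (μ₀ : Measure X)), hg₀⟩
  obtain ⟨μ, ⟨hμ1, hμ2⟩, hmin⟩ :=
    ((lowerSemicontinuous_cost husc hr).lowerSemicontinuousOn _).exists_isMinOn hne' hcpt
  refine ⟨μ, ⟨lt_of_le_of_lt hμ1 h₀, hμ2⟩, fun ν hν => ?_⟩
  rcases le_total (cost r (ν : Measure X)) (cost r (μ₀ : Measure X)) with h | h
  · exact hmin ⟨h, hν.2⟩
  · exact le_trans hμ1 h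

/-- Reduces infinitely many constraints to finitely many. The laws violating a finite subfamily, or
the value `c`, by more than `e n` form a directed open cover, and compactness extracts one member.
The margin `ε` later replaces a Slater condition. -/
lemma exists_uniform_violation {ι : Type*} {r : X → ℝ} {g : ι → X → ℝ}
    (hr : ∀ x, r x ≤ 0) (hrc : ∀ ε : ℝ, 0 ≤ ε → IsCompact {x | -ε ≤ r x})
    (hg : ∀ i, UpperSemicontinuous (g i)) (hgb : ∀ i, ∃ B, ∀ x, |g i x| ≤ B) {c : ℝ}
    (hc0 : c ≤ 0) (hc : ∀ μ, MomentFeasible r g μ → ∫ x, r x ∂(μ : Measure X) < c) :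
    ∃ (s : Finset ι) (ε : ℝ), 0 < ε ∧ ∀ μ : ProbabilityMeasure X, cost r (μ : Measure X) < ∞ →
      ∫ x, r x ∂(μ : Measure X) < c - ε ∨ ∃ i ∈ s, ∫ x, g i x ∂(μ : Measure X) < -ε := by
  classical
  have husc := upperSemicontinuous_of_isCompact_levels hr hrc
  let e : ℕ → ℝ := fun n => 1 / ((n : ℝ) + 1)
  have he : ∀ n, 0 < e n := fun n => by positivity
  have he0 : Tendsto e atTop (𝓝 0) := tendsto_one_div_add_atTop_nhds_zero_nat
  let U : Finset ι × ℕ → Set (ProbabilityMeasure X) := fun p =>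
    {μ | ENNReal.ofReal (-c + e p.2) < cost r (μ : Measure X)} ∪
      ⋃ i ∈ p.1, {μ | ∫ x, g i x ∂(μ : Measure X) < -e p.2}
  have hU : ∀ p, IsOpen (U p) := fun p => by
    refine IsOpen.union ((lowerSemicontinuous_cost husc hr).isOpen_preimage _) ?_
    refine isOpen_biUnion fun i _ => ?_
    obtain ⟨B, hB⟩ := hgb i
    exact (upperSemicontinuous_integral (hg i) hB).isOpen_preimage _
  have hmono : ∀ p q : Finset ι × ℕ, p ≤ q → U p ⊆ U q := by
    rintro ⟨s, n⟩ ⟨s', n'⟩ ⟨hs, hn⟩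
    have hen : e n' ≤ e n := by
      have : (n : ℝ) ≤ n' := by exact_mod_cast hn
      exact one_div_le_one_div_of_le (by positivity) (by linarith)
    refine Set.union_subset_union (fun μ hμ => ?_) (fun μ hμ => ?_)
    · exact lt_of_le_of_lt (ENNReal.ofReal_le_ofReal (by simpa using hen)) hμ
    · simp only [Set.mem_iUnion, exists_prop] at hμ ⊢
      obtain ⟨i, hi, h⟩ := hμ
      exact ⟨i, hs hi, lt_of_lt_of_le h (neg_le_neg hen)⟩
  have hcover : ∀ μ : ProbabilityMeasure X, ∃ p, μ ∈ U p := by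
    intro μ
    by_cases hfeas : ∀ i, 0 ≤ ∫ x, g i x ∂(μ : Measure X)
    · have hlt : ENNReal.ofReal (-c) < cost r (μ : Measure X) := by
        rcases eq_or_ne (cost r (μ : Measure X)) ∞ with h | h
        · exact h ▸ ENNReal.ofReal_lt_top
        · have := hc μ ⟨h.lt_top, hfeas⟩
          rw [integral_eq_neg_cost husc.measurable hr] at this
          exact (ENNReal.ofReal_lt_iff_lt_toReal (by linarith) h).2 (by linarith)
      have hlim : Tendsto (fun n => ENNReal.ofReal (-c + e n)) atTop (𝓝 (ENNReal.ofReal (-c))) := by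
        simpa using ENNReal.tendsto_ofReal (he0.const_add (-c))
      obtain ⟨n, hn⟩ := (hlim.eventually (gt_mem_nhds hlt)).exists
      exact ⟨(∅, n), Or.inl hn⟩
    · push Not at hfeas
      obtain ⟨i, hi⟩ := hfeas
      obtain ⟨n, hn⟩ := ((he0.neg).eventually (lt_mem_nhds (a := ∫ x, g i x ∂(μ : Measure X))
        (by simpa using hi))).exists
      exact ⟨({i}, n), Or.inr (by simpa using hn)⟩
  -- Only laws of cost at most `-c + 1` need covering: since `e n ≤ 1`, costlier ones violate the
  -- value `c` by more than `e n` anyway.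
  obtain ⟨⟨s, n⟩, hsn⟩ := (isCompact_cost_le hr hrc
    (ENNReal.ofReal_ne_top (r := -c + 1))).elim_directed_cover U hU
    (fun μ _ => Set.mem_iUnion.2 (hcover μ)) (fun p q => ⟨p ⊔ q, hmono _ _ le_sup_left,
      hmono _ _ le_sup_right⟩)
  refine ⟨s, e n, he n, fun μ hμ => ?_⟩
  have hmem : μ ∈ U (s, n) := by
    by_cases h : cost r (μ : Measure X) ≤ ENNReal.ofReal (-c + 1)
    · exact hsn h
    · refine Or.inl (lt_of_le_of_lt (ENNReal.ofReal_le_ofReal ?_) (not_le.1 h))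
      have : e n ≤ 1 := by
        refine (div_le_one (by positivity)).2 ?_
        linarith [(Nat.cast_nonneg n : (0 : ℝ) ≤ n)]
      simpa using this
  rcases hmem with h | h
  · left
    have := (ENNReal.ofReal_lt_iff_lt_toReal (by linarith [he n]) hμ.ne).1 h
    rw [integral_eq_neg_cost husc.measurable hr]
    linarith
  · right
    simpa using h

/-- Strong duality for the moment problem: if every feasible law has `∫ r dμ < c`, then `c`
dominates `r` plus a nonnegative combination of the constraint functions. -/
theorem exists_multipliers {ι : Type*} {r : X → ℝ} {g : ι → X → ℝ}
    (hr : ∀ x, r x ≤ 0) (hrc : ∀ ε : ℝ, 0 ≤ ε → IsCompact {x | -ε ≤ r x})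
    (hg : ∀ i, UpperSemicontinuous (g i)) (hgb : ∀ i, ∃ B, ∀ x, |g i x| ≤ B) {c : ℝ}
    (hne : ∃ μ, MomentFeasible r g μ)
    (hc : ∀ μ, MomentFeasible r g μ → ∫ x, r x ∂(μ : Measure X) < c) :
    ∃ (s : Finset ι) (l : ι → NNReal), ∀ x, r x + ∑ i ∈ s, (l i : ℝ) * g i x ≤ c := by
  classical
  rcases lt_or_ge 0 c with hc0 | hc0
  · exact ⟨∅, 0, fun x => by simpa using (hr x).trans hc0.le⟩
  have husc := upperSemicontinuous_of_isCompact_levels hr hrc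
  obtain ⟨s, ε, hε, hs⟩ := exists_uniform_violation hr hrc hg hgb hc0 hc
  have hgint : ∀ i (μ : Measure X) [IsFiniteMeasure μ], Integrable (g i) μ := fun i μ _ => by
    obtain ⟨B, hB⟩ := hgb i
    exact integrable_of_usc_bounded (hg i) hB μ
  -- The shift by `ε` uses up the margin: every image point still has a negative coordinate, while a
  -- feasible law has constraint coordinates at least `ε`.
  let Φ : ProbabilityMeasure X → Option s → ℝ := fun μ o =>
    o.elim (∫ x, r x ∂(μ : Measure X) - c + ε) fun i => ∫ x, g i x ∂(μ : Measure X) + ε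
  let D : Set (Option s → ℝ) := Φ '' {μ | Integrable r (μ : Measure X)}
  have hconv : Convex ℝ D := by
    rintro _ ⟨μ, hμ, rfl⟩ _ ⟨ν, hν, rfl⟩ p q hp hq hpq
    have hprob : IsProbabilityMeasure
        (ENNReal.ofReal p • (μ : Measure X) + ENNReal.ofReal q • (ν : Measure X)) := ⟨by
      simp [← ENNReal.ofReal_add hp hq, hpq]⟩
    have hmix : ∀ f : X → ℝ, Integrable f (μ : Measure X) → Integrable f (ν : Measure X) →
        ∫ x, f x ∂(ENNReal.ofReal p • (μ : Measure X) + ENNReal.ofReal q • (ν : Measure X))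
          = p * ∫ x, f x ∂(μ : Measure X) + q * ∫ x, f x ∂(ν : Measure X) := by
      intro f h1 h2
      rw [integral_add_measure (h1.smul_measure ENNReal.ofReal_ne_top)
        (h2.smul_measure ENNReal.ofReal_ne_top), integral_smul_measure, integral_smul_measure,
        ENNReal.toReal_ofReal hp, ENNReal.toReal_ofReal hq, smul_eq_mul, smul_eq_mul]
    refine ⟨⟨_, hprob⟩, ?_, ?_⟩
    · exact (Integrable.smul_measure hμ ENNReal.ofReal_ne_top).add_measure
        (Integrable.smul_measure hν ENNReal.ofReal_ne_top)
    · ext o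
      rcases o with _ | i
      · simp only [Φ, Option.elim_none, ProbabilityMeasure.coe_mk, hmix r hμ hν, Pi.add_apply,
          Pi.smul_apply, smul_eq_mul]
        linear_combination (c - ε) * hpq
      · simp only [Φ, Option.elim_some, ProbabilityMeasure.coe_mk,
          hmix (g i) (hgint _ _) (hgint _ _), Pi.add_apply, Pi.smul_apply, smul_eq_mul]
        linear_combination (-ε) * hpq
  obtain ⟨μ₀, hμ₀, hgμ₀⟩ := hne
  have hrint₀ := integrable_of_cost_lt_top husc.measurable hr hμ₀
  obtain ⟨l, hl0, ⟨o, ho⟩, hl⟩ := exists_nonneg_separating hconv ⟨_, μ₀, hrint₀, rfl⟩ (by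
    rintro _ ⟨μ, hμ, rfl⟩
    rcases hs μ (cost_lt_top_of_integrable hμ) with h | ⟨i, hi, h⟩
    · exact ⟨none, by simp only [Φ, Option.elim_none]; linarith⟩
    · exact ⟨some ⟨i, hi⟩, by simp only [Φ, Option.elim_some]; linarith⟩)
  have hl' : ∀ μ : ProbabilityMeasure X, Integrable r (μ : Measure X) →
      l none * (∫ x, r x ∂(μ : Measure X) - c + ε)
        + ∑ i : s, l (some i) * (∫ x, g i x ∂(μ : Measure X) + ε) ≤ 0 := by
    intro μ hμ
    have := hl _ ⟨μ, hμ, rfl⟩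
    rwa [Fintype.sum_option] at this
  -- If the multiplier of `r` vanished, the strictly positive constraint coordinates of the feasible
  -- `μ₀` would force all other multipliers to vanish too.
  have hpos : 0 < l none := by
    refine lt_of_le_of_ne (hl0 none) fun h0 => ?_
    have h1 := hl' μ₀ hrint₀
    rw [← h0, zero_mul, zero_add] at h1
    have h2 : ∀ i : s, 0 ≤ l (some i) * (∫ x, g i x ∂(μ₀ : Measure X) + ε) := fun i =>
      mul_nonneg (hl0 _) (add_nonneg (hgμ₀ i) hε.le)
    have h3 := (Finset.sum_eq_zero_iff_of_nonneg fun i _ => h2 i).1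
      (le_antisymm h1 (Finset.sum_nonneg fun i _ => h2 i))
    rcases o with _ | i
    · exact ho h0.symm
    · rcases mul_eq_zero.1 (h3 i (Finset.mem_univ _)) with h | h
      · exact ho h
      · linarith [hgμ₀ i]
  refine ⟨s, fun i => if hi : i ∈ s then (l (some ⟨i, hi⟩) / l none).toNNReal else 0,
    fun x => ?_⟩
  -- Dirac masses have finite cost, and turn the integrated inequality into a pointwise one.
  have hx := hl' ⟨Measure.dirac x, inferInstance⟩
    (integrable_of_cost_lt_top husc.measurable hr (by
      simp only [cost, ProbabilityMeasure.coe_mk]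
      rw [lintegral_dirac]
      exact ENNReal.ofReal_lt_top))
  simp only [ProbabilityMeasure.coe_mk, integral_dirac] at hx
  rw [← Finset.sum_coe_sort s]
  have hsum : ∑ i : s, (((if hi : (i : ι) ∈ s then (l (some ⟨i, hi⟩) / l none).toNNReal else 0 :
      NNReal) : ℝ) * g i x) = (∑ i : s, l (some i) * g i x) / l none := by
    rw [Finset.sum_div]
    refine Finset.sum_congr rfl fun i _ => ?_
    rw [dif_pos i.2, Real.coe_toNNReal _ (div_nonneg (hl0 _) hpos.le)]
    ring
  rw [hsum]
  have hle : ∑ i : s, l (some i) * g i x ≤ ∑ i : s, l (some i) * (g i x + ε) :=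
    Finset.sum_le_sum fun i _ => mul_le_mul_of_nonneg_left (by linarith) (hl0 _)
  have h4 : (∑ i : s, l (some i) * g i x) / l none ≤ c - r x := by
    rw [div_le_iff₀ hpos]
    nlinarith
  linarith

end Semicontinuity

end

lemma integrable_and_integral_comp {X Y : Type*} [MeasurableSpace X] [MeasurableSpace Y]
    {κ : Kernel X Y} {m : Measure X} {f : Y → ℝ} (hf : Integrable f (κ ∘ₘ m)) :
    Integrable (fun x => ∫ y, f y ∂(κ x)) m ∧
      ∫ y, f y ∂(κ ∘ₘ m) = ∫ x, ∫ y, f y ∂(κ x) ∂m := by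
  rw [Measure.comp_eq_comp_const_apply] at hf ⊢
  exact ⟨by simpa using hf.integral_comp, by simpa using Kernel.integral_comp hf⟩

/-! ### Nonnegative signed measures as finite measures. -/

section SignedMeasures

variable {X : Type*} [MeasurableSpace X]

lemma pairing_toSignedMeasure (m : Measure X) [IsFiniteMeasure m] (f : X → ℝ) :
    pairing m.toSignedMeasure f = ∫ x, f x ∂m :=
  VectorMeasure.integral_toSignedMeasure

lemma exists_toSignedMeasure_eq {μ : SignedMeasure X} (h : 0 ≤ μ) :
    ∃ (m : Measure X) (_ : IsFiniteMeasure m), m.toSignedMeasure = μ :=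
  ⟨_, inferInstance, SignedMeasure.toMeasureOfZeroLE_toSignedMeasure μ
    ((VectorMeasure.le_restrict_univ_iff_le _ _).2 h)⟩

/-- The weight is `1 + (-r)`, and the summand `1` contributes only the finite total mass. -/
lemma mem_weightedMeasures_toSignedMeasure {r : X → ℝ} (hr : ∀ x, r x ≤ 0)
    (m : Measure X) [IsFiniteMeasure m] :
    m.toSignedMeasure ∈ weightedMeasures (fun x => 1 - r x) ↔ cost r m < ∞ := by
  change ∫⁻ x, ENNReal.ofReal (1 - r x) ∂m.toSignedMeasure.totalVariation < ∞ ↔ _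
  rw [SignedMeasure.totalVariation_eq_variation, Measure.variation_toSignedMeasure]
  have : ∀ x, ENNReal.ofReal (1 - r x) = 1 + ENNReal.ofReal (-r x) := fun x => by
    rw [sub_eq_add_neg, ENNReal.ofReal_add zero_le_one (neg_nonneg.2 (hr x)), ENNReal.ofReal_one]
  simp_rw [this]
  rw [lintegral_add_left measurable_const, ENNReal.add_lt_top]
  simp [cost]

end SignedMeasures

lemma minusPart_nonpos (x : ℝ) : minusPart x ≤ 0 := min_le_right _ _

lemma abs_minusPart_le (x : ℝ) : |minusPart x| ≤ |x| := by
  unfold minusPart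
  rw [abs_le]
  constructor
  · exact le_min (neg_abs_le x) (neg_nonpos.2 (abs_nonneg x))
  · exact (min_le_right _ _).trans (abs_nonneg x)

lemma continuous_minusPart : Continuous minusPart := by
  unfold minusPart; fun_prop

lemma monotone_minusPart : Monotone minusPart := fun _ _ h => min_le_min_right 0 h

lemma upperSemicontinuous_minusPart_sub {X : Type*} [TopologicalSpace X] {z : X → ℝ}
    (hz : UpperSemicontinuous z) (η : ℝ) : UpperSemicontinuous fun k => minusPart (z k - η) :=
  Continuous.comp_upperSemicontinuous (g := fun x => minusPart (x - η))
    (continuous_minusPart.comp (continuous_id.sub continuous_const)) hz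
    fun _ _ h => monotone_minusPart (sub_le_sub_right h η)

/-! ### The two linear programs: reduction to the moment problem, and duality. -/

namespace MDP

section Weights

variable {S A : Type*} [TopologicalSpace S] [MeasurableSpace S]
  [TopologicalSpace A] [MeasurableSpace A] (M : MDP S A)

lemma one_le_wHat (hr : ∀ k, M.r k ≤ 0) (s : S) : 1 ≤ M.wHat s := by
  have : (⨆ a : {a : A // (s, a) ∈ M.K}, M.r ⟨(s, a.1), a.2⟩) ≤ 0 :=
    Real.iSup_nonpos fun _ => hr _
  unfold wHat
  linarith

lemma wHat_le_w (hr : ∀ k, M.r k ≤ 0) (k : M.K) : M.wHat k.1.1 ≤ M.w k := by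
  have : M.r k ≤ ⨆ a : {a : A // (k.1.1, a) ∈ M.K}, M.r ⟨(k.1.1, a.1), a.2⟩ :=
    le_ciSup (f := fun a : {a : A // (k.1.1, a) ∈ M.K} => M.r ⟨(k.1.1, a.1), a.2⟩)
      ⟨0, by rintro _ ⟨a, rfl⟩; exact hr _⟩ ⟨k.1.2, k.2⟩
  unfold wHat w
  linarith

lemma measurable_fst_K : Measurable fun k : M.K => k.1.1 :=
  measurable_fst.comp measurable_subtype_coe

lemma integrable_and_integral_L0Adj {m : Measure M.K} [IsFiniteMeasure m] {h : S → ℝ}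
    (h1 : Integrable h (m.map fun k => k.1.1)) (h2 : Integrable h (M.Q ∘ₘ m)) :
    Integrable (M.L0Adj h) m ∧
      ∫ k, M.L0Adj h k ∂m = ∫ s, h s ∂(m.map fun k : M.K => k.1.1) - ∫ s, h s ∂(M.Q ∘ₘ m) := by
  have hi1 : Integrable (fun k : M.K => h k.1.1) m :=
    (integrable_map_measure h1.aestronglyMeasurable M.measurable_fst_K.aemeasurable).1 h1
  have hi2 : Integrable (fun k : M.K => ∫ ξ, h ξ ∂(M.Q k)) m :=
    (integrable_and_integral_comp h2).1
  refine ⟨hi1.sub hi2, ?_⟩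
  unfold L0Adj
  rw [integral_sub hi1 hi2, integral_map M.measurable_fst_K.aemeasurable h1.aestronglyMeasurable,
    (integrable_and_integral_comp h2).2]

lemma L0_toSignedMeasure_eq_zero_iff (m : Measure M.K) [IsFiniteMeasure m] :
    M.L0 m.toSignedMeasure = 0 ↔ m.map (fun k => k.1.1) = M.Q ∘ₘ m := by
  have key : ∀ B, MeasurableSet B → M.L0 m.toSignedMeasure B
      = (m.map fun k : M.K => k.1.1).real B - (M.Q ∘ₘ m).real B := by
    intro B hB
    have hB' : MeasurableSet {k : M.K | k.1.1 ∈ B} := M.measurable_fst_K hB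
    rw [M.L0_apply _ hB, pairing_toSignedMeasure,
      Measure.toSignedMeasure_apply_measurable hB', measureReal_def,
      measureReal_def, measureReal_def, Measure.map_apply M.measurable_fst_K hB,
      Measure.bind_apply hB M.Q.aemeasurable,
      integral_toReal (M.Q.measurable_coe hB).aemeasurable
        (ae_of_all _ fun k => measure_lt_top _ _)]
    rfl
  constructor
  · intro h
    ext B hB
    have := key B hB
    rw [h, _root_.zero_apply] at this
    exact (measureReal_eq_measureReal_iff).1 (sub_eq_zero.1 this.symm)
  · intro h
    refine VectorMeasure.ext fun B hB => ?_
    rw [key B hB, h, sub_self, _root_.zero_apply]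

end Weights

variable {S A : Type*}
    [TopologicalSpace S] [TopologicalSpace.MetrizableSpace S] [SecondCountableTopology S]
    [MeasurableSpace S] [BorelSpace S]
    [TopologicalSpace A] [TopologicalSpace.MetrizableSpace A] [SecondCountableTopology A]
    [MeasurableSpace A] [BorelSpace A] (M : MDP S A)

/-- The functions whose integrals must be nonnegative: `L₀*h` for `h` bounded and continuous, and
`(z - η)₋ - y(η)` for `η ∈ [a, b]`. -/
noncomputable def constraintFn (z : M.K → ℝ) (a b : ℝ) (y : Set.Icc a b → ℝ) :
    (S →ᵇ ℝ) ⊕ Set.Icc a b → M.K → ℝ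
  | Sum.inl h => M.L0Adj h
  | Sum.inr η => fun k => minusPart (z k - η) - y η

variable {M} {z : M.K → ℝ} {a b : ℝ} {y : Set.Icc a b → ℝ}

lemma upperSemicontinuous_constraintFn
    (hQ : ∀ g : S →ᵇ ℝ, Continuous fun k : M.K => ∫ ξ, g ξ ∂(M.Q k))
    (hz : UpperSemicontinuous z) (i) : UpperSemicontinuous (M.constraintFn z a b y i) := by
  rcases i with h | η
  · exact ((h.continuous.comp (continuous_fst.comp continuous_subtype_val)).sub
      (hQ h)).upperSemicontinuous
  · have := (upperSemicontinuous_minusPart_sub hz η).add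
      (continuous_const (y := -y η)).upperSemicontinuous
    simpa [constraintFn, sub_eq_add_neg] using this

lemma exists_bound_constraintFn (hzb : ∃ C : ℝ, ∀ k, |z k| ≤ C) (i) :
    ∃ B, ∀ k, |M.constraintFn z a b y i k| ≤ B := by
  rcases i with h | η
  · refine ⟨‖h‖ + ‖h‖, fun k => (abs_sub _ _).trans (add_le_add (h.norm_coe_le_norm _) ?_)⟩
    refine (norm_integral_le_of_norm_le_const (ae_of_all _ h.norm_coe_le_norm)).trans ?_
    simp
  · obtain ⟨C, hC⟩ := hzb
    refine ⟨C + |(η : ℝ)| + |y η|, fun k => (abs_sub _ _).trans (add_le_add ?_ le_rfl)⟩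
    exact (abs_minusPart_le _).trans ((abs_sub _ _).trans (add_le_add (hC k) le_rfl))

/-- Testing with `h` and `-h` turns the inequalities into equalities, and bounded continuous
functions determine a finite measure on a metrizable space. -/
lemma integral_L0Adj_nonneg_iff (m : Measure M.K) [IsProbabilityMeasure m] :
    (∀ h : S →ᵇ ℝ, 0 ≤ ∫ k, M.L0Adj h k ∂m) ↔ m.map (fun k => k.1.1) = M.Q ∘ₘ m := by
  have : IsProbabilityMeasure (m.map fun k : M.K => k.1.1) :=
    Measure.isProbabilityMeasure_map M.measurable_fst_K.aemeasurable
  have key : ∀ h : S →ᵇ ℝ, ∫ k, M.L0Adj h k ∂m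
      = ∫ s, h s ∂(m.map fun k : M.K => k.1.1) - ∫ s, h s ∂(M.Q ∘ₘ m) := fun h =>
    (M.integrable_and_integral_L0Adj (h.integrable _) (h.integrable _)).2
  constructor
  · intro h
    refine ext_of_forall_integral_eq_of_IsFiniteMeasure fun f => ?_
    have h1 := h f
    have h2 := h (-f)
    rw [key] at h1 h2
    simp only [BoundedContinuousFunction.coe_neg, Pi.neg_apply, integral_neg] at h2
    linarith
  · intro h f
    rw [key, h, sub_self]

lemma integrable_minusPart_sub (hz : UpperSemicontinuous z) (hzb : ∃ C : ℝ, ∀ k, |z k| ≤ C)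
    (η : ℝ) (m : Measure M.K) [IsFiniteMeasure m] :
    Integrable (fun k => minusPart (z k - η)) m := by
  obtain ⟨C, hC⟩ := hzb
  exact integrable_of_usc_bounded (upperSemicontinuous_minusPart_sub hz η) (B := C + |η|)
    (fun k => (abs_minusPart_le _).trans ((abs_sub _ _).trans (add_le_add (hC k) le_rfl))) m

lemma momentFeasible_iff (hz : UpperSemicontinuous z) (hzb : ∃ C : ℝ, ∀ k, |z k| ≤ C)
    (m : ProbabilityMeasure M.K) :
    MomentFeasible M.r (M.constraintFn z a b y) m ↔ cost M.r (m : Measure M.K) < ∞ ∧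
      (m : Measure M.K).map (fun k => k.1.1) = M.Q ∘ₘ (m : Measure M.K) ∧
      ∀ η : Set.Icc a b, y η ≤ ∫ k, minusPart (z k - η) ∂(m : Measure M.K) := by
  unfold MomentFeasible
  rw [← integral_L0Adj_nonneg_iff, Sum.forall]
  refine and_congr_right fun _ => and_congr Iff.rfl (forall_congr' fun η => ?_)
  simp only [constraintFn]
  rw [integral_sub (integrable_minusPart_sub hz hzb _ _) (integrable_const _)]
  simp

lemma mem_primalFeasible_iff (hr : ∀ k, M.r k ≤ 0) (hz : UpperSemicontinuous z)
    (hzb : ∃ C : ℝ, ∀ k, |z k| ≤ C) (μ : SignedMeasure M.K) :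
    μ ∈ M.primalFeasible z a b y ↔ ∃ m : ProbabilityMeasure M.K,
      MomentFeasible M.r (M.constraintFn z a b y) m ∧ (m : Measure M.K).toSignedMeasure = μ := by
  constructor
  · rintro ⟨h0, h1, hy, hw, hnn⟩
    obtain ⟨m, hm, rfl⟩ := exists_toSignedMeasure_eq hnn
    rw [pairing_toSignedMeasure] at h1
    have hprob : IsProbabilityMeasure m := ⟨by
      have : m.real Set.univ = 1 := by simpa using h1
      rwa [measureReal_def, ENNReal.toReal_eq_one_iff] at this⟩
    refine ⟨⟨m, hprob⟩, (momentFeasible_iff hz hzb _).2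
      ⟨(mem_weightedMeasures_toSignedMeasure hr m).1 hw,
        (M.L0_toSignedMeasure_eq_zero_iff m).1 h0, fun η => ?_⟩, rfl⟩
    have := hy η
    rwa [L1, pairing_toSignedMeasure] at this
  · rintro ⟨m, hm, rfl⟩
    obtain ⟨hc, h0, hy⟩ := (momentFeasible_iff hz hzb _).1 hm
    refine ⟨(M.L0_toSignedMeasure_eq_zero_iff _).2 h0, ?_, fun η => ?_,
      (mem_weightedMeasures_toSignedMeasure hr _).2 hc, Measure.zero_le_toSignedMeasure _⟩
    · rw [pairing_toSignedMeasure]; simp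
    · rw [L1, pairing_toSignedMeasure]; exact hy η

/-- Weak duality. -/
lemma integral_le_of_dualFeasible (hr : ∀ k, M.r k ≤ 0) (hz : UpperSemicontinuous z)
    (hzb : ∃ C : ℝ, ∀ k, |z k| ≤ C) (hy : Continuous y) {m : ProbabilityMeasure M.K}
    (hm : MomentFeasible M.r (M.constraintFn z a b y) m)
    {d : (S → ℝ) × ℝ × SignedMeasure (Set.Icc a b)} (hd : d ∈ M.dualFeasible z a b) :
    ∫ k, M.r k ∂(m : Measure M.K) ≤ d.2.1 - pairing d.2.2 y := by
  obtain ⟨h, β, Λ⟩ := d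
  obtain ⟨hle, ⟨hh, B, hB⟩, hΛ⟩ := hd
  obtain ⟨Λ, hfin, rfl⟩ := exists_toSignedMeasure_eq hΛ
  obtain ⟨hc, hinv, hmy⟩ := (momentFeasible_iff hz hzb _).1 hm
  dsimp only at *
  have hrint := integrable_of_cost_lt_top M.measurable_r hr hc
  -- Along `K` one has `|h| ≤ |B| ŵ ≤ |B| w`, and `w = 1 - r` is integrable since the cost is
  -- finite.
  have hhint : Integrable h ((m : Measure M.K).map fun k : M.K => k.1.1) := by
    rw [integrable_map_measure hh.aestronglyMeasurable M.measurable_fst_K.aemeasurable]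
    refine Integrable.mono' (g := fun k => |B| * M.w k) (((integrable_const 1).sub hrint).const_mul _)
      (hh.comp M.measurable_fst_K).aestronglyMeasurable (ae_of_all _ fun k => ?_)
    have h1 : |h k.1.1| / M.wHat k.1.1 ≤ B := hB ⟨k.1.1, rfl⟩
    have h2 := M.one_le_wHat hr k.1.1
    rw [div_le_iff₀ (by linarith)] at h1
    exact h1.trans ((mul_le_mul_of_nonneg_right (le_abs_self B) (by linarith)).trans
      (mul_le_mul_of_nonneg_left (M.wHat_le_w hr k) (abs_nonneg B)))
  -- Invariance transfers integrability of `h` to `Q ∘ₘ m`, and makes the integral of `L₀*h` zero.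
  obtain ⟨hL0int, hL0⟩ := M.integrable_and_integral_L0Adj hhint (hinv ▸ hhint)
  rw [hinv, sub_self] at hL0
  obtain ⟨C, hC⟩ := hzb
  have hjoint : Integrable (fun p : M.K × Set.Icc a b => minusPart (z p.1 - p.2))
      ((m : Measure M.K).prod Λ) := by
    refine Integrable.of_bound (C := C + (|a| + |b|)) ?_ (ae_of_all _ fun p => ?_)
    · exact (continuous_minusPart.measurable.comp ((hz.measurable.comp measurable_fst).sub
        (measurable_subtype_coe.comp measurable_snd))).aestronglyMeasurable
    · have h2 : |(p.2 : ℝ)| ≤ |a| + |b| := (abs_le_max_abs_abs p.2.2.1 p.2.2.2).trans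
        (max_le_add_of_nonneg (abs_nonneg _) (abs_nonneg _))
      exact (abs_minusPart_le _).trans ((abs_sub _ _).trans (add_le_add (hC _) h2))
  have hL1 : ∀ k, M.L1Adj z a b Λ.toSignedMeasure k = ∫ η, minusPart (z k - η) ∂Λ := fun k =>
    pairing_toSignedMeasure _ _
  simp_rw [hL1] at hle
  have hint1 : Integrable (fun k => ∫ η : Set.Icc a b, minusPart (z k - η) ∂Λ) (m : Measure M.K) :=
    hjoint.integral_prod_left
  have hyint : Integrable y Λ := hy.integrable_of_hasCompactSupport (HasCompactSupport.of_compactSpace y)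
  -- Fubini, after integrating the dominance constraints against `Λ ≥ 0`.
  have hswap : ∫ η, y η ∂Λ ≤ ∫ k, ∫ η : Set.Icc a b, minusPart (z k - η) ∂Λ ∂(m : Measure M.K) := by
    rw [integral_integral_swap (f := fun k (η : Set.Icc a b) => minusPart (z k - η)) hjoint]
    exact integral_mono hyint hjoint.integral_prod_right hmy
  have htot : ∫ k, (M.r k + M.L0Adj h k - β + ∫ η : Set.Icc a b, minusPart (z k - η) ∂Λ)
      ∂(m : Measure M.K) ≤ 0 := integral_nonpos hle
  have hint2 : Integrable (fun k => M.r k + M.L0Adj h k) (m : Measure M.K) := hrint.add hL0int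
  have hint3 : Integrable (fun k => M.r k + M.L0Adj h k - β) (m : Measure M.K) :=
    hint2.sub (integrable_const _)
  rw [integral_add hint3 hint1, integral_sub hint2 (integrable_const _),
    integral_add hrint hL0int, hL0] at htot
  simp only [integral_const, probReal_univ, smul_eq_mul, one_mul] at htot
  rw [pairing_toSignedMeasure]
  linarith

lemma L0Adj_sum {ι : Type*} (s : Finset ι) (l : ι → ℝ) (h : ι → S →ᵇ ℝ) (k : M.K) :
    M.L0Adj (∑ i ∈ s, l i • h i : S →ᵇ ℝ) k = ∑ i ∈ s, l i * M.L0Adj (h i) k := by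
  have hi : ∀ i ∈ s, Integrable (fun ξ => l i * h i ξ) (M.Q k) := fun i _ =>
    ((h i).integrable _).const_mul _
  unfold L0Adj
  simp only [BoundedContinuousFunction.coe_sum, BoundedContinuousFunction.coe_smul,
    Finset.sum_apply, smul_eq_mul, mul_sub, Finset.sum_sub_distrib]
  rw [integral_finsetSum _ hi]
  simp only [integral_const_mul]

/-- Strong duality, in the form of approximate dual solutions. -/
lemma exists_dualFeasible_le (hr : ∀ k, M.r k ≤ 0)
    (hrc : ∀ ε : ℝ, 0 ≤ ε → IsCompact {k : M.K | -ε ≤ M.r k})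
    (hzb : ∃ C : ℝ, ∀ k, |z k| ≤ C) (hz : UpperSemicontinuous z)
    (hQ : ∀ g : S →ᵇ ℝ, Continuous fun k : M.K => ∫ ξ, g ξ ∂(M.Q k)) {c : ℝ}
    (hne : ∃ m, MomentFeasible M.r (M.constraintFn z a b y) m)
    (hc : ∀ m, MomentFeasible M.r (M.constraintFn z a b y) m →
      ∫ k, M.r k ∂(m : Measure M.K) < c) :
    ∃ d ∈ M.dualFeasible z a b, d.2.1 - pairing d.2.2 y = c := by
  obtain ⟨s, l, hl⟩ := exists_multipliers hr hrc (upperSemicontinuous_constraintFn hQ hz)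
    (exists_bound_constraintFn hzb) hne hc
  -- The multipliers of the invariance constraints are absorbed into one function `h`; those of the
  -- dominance constraints become the atoms of `Λ`.
  let h : S →ᵇ ℝ := ∑ i ∈ s, (l i : ℝ) • Sum.elim id (fun _ => (0 : S →ᵇ ℝ)) i
  let Λ : Measure (Set.Icc a b) := ∑ i ∈ s, l i • Sum.elim (fun _ => 0) Measure.dirac i
  have hΛfin : ∀ i, IsFiniteMeasure
      (Sum.elim (fun _ : S →ᵇ ℝ => (0 : Measure (Set.Icc a b))) Measure.dirac i) := by
    rintro (i | i) <;> simp only [Sum.elim_inl, Sum.elim_inr] <;> infer_instance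
  have hΛ : ∀ f : Set.Icc a b → ℝ,
      ∫ η, f η ∂Λ = ∑ i ∈ s, (l i : ℝ) * Sum.elim (fun _ => 0) f i := by
    intro f
    have hi : ∀ i ∈ s, Integrable f (l i • Sum.elim (fun _ => 0) Measure.dirac i) := by
      rintro (i | i) _
      · simp
      · exact (integrable_dirac (by simp)).smul_measure_nnreal
    rw [integral_finsetSum_measure hi]
    refine Finset.sum_congr rfl fun i _ => ?_
    rw [integral_smul_nnreal_measure]
    rcases i with i | i <;> simp [NNReal.smul_def]
  have : IsFiniteMeasure Λ := inferInstance
  -- The term `∫ y dΛ` in `β` absorbs the constants `-y η` of the constraint functions, and makes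
  -- the dual objective exactly `c`.
  refine ⟨(h, c + ∫ η, y η ∂Λ, Λ.toSignedMeasure), ⟨fun k => ?_, ⟨h.continuous.measurable, ‖h‖, ?_⟩,
    Measure.zero_le_toSignedMeasure _⟩, ?_⟩
  · have h1 := hl k
    have h2 : M.L1Adj z a b Λ.toSignedMeasure k = ∫ η, minusPart (z k - η) ∂Λ :=
      pairing_toSignedMeasure _ _
    simp only [h2]
    rw [hΛ, hΛ, L0Adj_sum s (fun i => (l i : ℝ))]
    have h3 : ∑ i ∈ s, (l i : ℝ) * M.constraintFn z a b y i k
        = ∑ i ∈ s, (l i : ℝ) * M.L0Adj (Sum.elim id (fun _ => 0) i : S →ᵇ ℝ) k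
          + ∑ i ∈ s, (l i : ℝ) * Sum.elim (fun _ => 0)
            (fun η : Set.Icc a b => minusPart (z k - η)) i
          - ∑ i ∈ s, (l i : ℝ) * Sum.elim (fun _ => 0) y i := by
      rw [← Finset.sum_add_distrib, ← Finset.sum_sub_distrib]
      refine Finset.sum_congr rfl fun i _ => ?_
      rcases i with i | i
      · simp [constraintFn]
      · simp [constraintFn, L0Adj, mul_sub]
    linarith
  · rintro _ ⟨x, rfl⟩
    have h1 := M.one_le_wHat hr x
    exact (div_le_self (abs_nonneg _) h1).trans (h.norm_coe_le_norm x)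
  · simp only [pairing_toSignedMeasure]
    ring

end MDP

lemma comap_comp_measure {X Y W : Type*} [MeasurableSpace X] [MeasurableSpace Y]
    [MeasurableSpace W] (κ : Kernel Y W) {g : X → Y} (hg : Measurable g) (m : Measure X) :
    (κ.comap g hg) ∘ₘ m = κ ∘ₘ (m.map g) := by
  ext B hB
  rw [Measure.bind_apply hB (Kernel.aemeasurable _), Measure.bind_apply hB (Kernel.aemeasurable _),
    lintegral_map (κ.measurable_coe hB) hg]
  rfl

/-! ### One-dimensional marginals of a trajectory measure. -/

section TrajMeasure

variable {E : Type*} [MeasurableSpace E] (μ₀ : Measure E) [IsProbabilityMeasure μ₀]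
  (κ : (n : ℕ) → Kernel ((_i : Finset.Iic n) → E) E) [∀ n, IsMarkovKernel (κ n)]

lemma map_zero_trajMeasure :
    (Kernel.trajMeasure (X := fun _ => E) μ₀ κ).map (fun x => x 0) = μ₀ := by
  have hf : Measurable fun y : (_i : Finset.Iic 0) → E => y ⟨0, Finset.mem_Iic.2 le_rfl⟩ :=
    measurable_pi_apply _
  have h1 : (fun x : ℕ → E => x 0)
      = (fun y : (_i : Finset.Iic 0) → E => y ⟨0, Finset.mem_Iic.2 le_rfl⟩) ∘
        Preorder.frestrictLe (π := fun _ => E) 0 := rfl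
  rw [h1, ← Measure.map_map hf (by fun_prop), Kernel.trajMeasure,
    Measure.map_comp _ _ (by fun_prop), Kernel.traj_map_frestrictLe, Kernel.partialTraj_self,
    Measure.id_comp, Measure.map_map hf (by fun_prop)]
  convert Measure.map_id
  funext x
  have h0 : (⟨0, Finset.mem_Iic.2 le_rfl⟩ : Finset.Iic 0) = default := Subsingleton.elim _ _
  simp [MeasurableEquiv.piUnique, h0]

lemma map_succ_trajMeasure (n : ℕ) :
    (Kernel.trajMeasure (X := fun _ => E) μ₀ κ).map (fun x => x (n + 1))
      = κ n ∘ₘ (Kernel.trajMeasure (X := fun _ => E) μ₀ κ).map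
          (Preorder.frestrictLe (π := fun _ => E) n) := by
  have h := congrArg Measure.snd
    (Kernel.map_frestrictLe_trajMeasure_compProd_eq_map_trajMeasure (X := fun _ => E)
      (μ₀ := μ₀) (κ := κ) (a := n))
  have : IsProbabilityMeasure ((Kernel.trajMeasure (X := fun _ => E) μ₀ κ).map
          (Preorder.frestrictLe (π := fun _ => E) n)) :=
    Measure.isProbabilityMeasure_map (by fun_prop)
  rw [Measure.snd_compProd, Measure.snd, Measure.map_map measurable_snd (by fun_prop)] at h
  exact h.symm

end TrajMeasure

/-! ### Laws of the state-action process, and stationary policies. -/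

namespace MDP

variable {S A : Type*}
    [TopologicalSpace S] [TopologicalSpace.MetrizableSpace S] [SecondCountableTopology S]
    [MeasurableSpace S] [BorelSpace S]
    [TopologicalSpace A] [TopologicalSpace.MetrizableSpace A] [SecondCountableTopology A]
    [MeasurableSpace A] [BorelSpace A] (M : MDP S A)

instance (π : M.Policy) (ν : ProbabilityMeasure S) : IsProbabilityMeasure (M.init π ν) := by
  have : IsProbabilityMeasure
      ((ν : Measure S).map (fun s : S => ((fun i => i.elim0 : Fin 0 → M.K), s))) :=
    Measure.isProbabilityMeasure_map (by fun_prop)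
  unfold init
  infer_instance

instance (π : M.Policy) (ν : ProbabilityMeasure S) : IsProbabilityMeasure (M.trajLaw π ν) := by
  unfold trajLaw
  infer_instance

lemma dirac_prod_K (s : S) {p : Measure A} [IsProbabilityMeasure p] (h : p {a | (s, a) ∈ M.K} = 1) :
    (Measure.dirac s).prod p M.K = 1 := by
  rw [Measure.prod_apply M.measurableSet_K,
    lintegral_dirac' _ (measurable_measure_prodMk_left M.measurableSet_K)]
  exact h

lemma map_comap_K {m : Measure (S × A)} [IsProbabilityMeasure m] (h : m M.K = 1) :
    (m.comap (Subtype.val : M.K → S × A)).map Subtype.val = m := by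
  rw [(MeasurableEmbedding.subtype_coe M.measurableSet_K).map_comap, Subtype.range_coe_subtype]
  refine Measure.restrict_eq_self_of_ae_mem ?_
  exact (prob_compl_eq_zero_iff M.measurableSet_K).2 h

/-- The law on `K` of `(s, a)` with `a ∼ φ(· | s)`. -/
noncomputable def selectorKernel (φ : Kernel S A) : Kernel S M.K :=
  (Kernel.id ×ₖ φ).comapRight (MeasurableEmbedding.subtype_coe M.measurableSet_K)

lemma map_stateAction (π : M.Policy) (t : ℕ) :
    (M.stateAction π t).map (fun k => k.1.1) = Kernel.deterministic Prod.snd measurable_snd := by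
  ext1 h
  rw [Kernel.map_apply _ M.measurable_fst_K]
  have h1 : (fun k : M.K => k.1.1) = Prod.fst ∘ Subtype.val := rfl
  rw [h1, ← Measure.map_map measurable_fst measurable_subtype_coe, stateAction,
    Kernel.comapRight_apply, Kernel.prod_apply, Kernel.deterministic_apply,
    M.map_comap_K (M.dirac_prod_K _ (π.feasible t h)), ← Measure.fst, Measure.fst_prod]

/-- The law of `(s_t, a_t)` under `P_ν^π`. -/
noncomputable def marginalLaw (π : M.Policy) (ν : ProbabilityMeasure S) (t : ℕ) : Measure M.K :=
  (M.trajLaw π ν).map fun x => x t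

instance (π : M.Policy) (ν : ProbabilityMeasure S) (t : ℕ) :
    IsProbabilityMeasure (M.marginalLaw π ν t) :=
  Measure.isProbabilityMeasure_map (measurable_pi_apply t).aemeasurable

lemma map_step (π : M.Policy) (t : ℕ) :
    (M.step π t).map (fun k => k.1.1) =
      M.Q.comap (fun x : (_i : Finset.Iic t) → M.K => x ⟨t, Finset.mem_Iic.2 le_rfl⟩)
        (measurable_pi_apply _) := by
  rw [step, Kernel.map_comp, map_stateAction, Kernel.deterministic_comp_eq_map, ← Kernel.snd_eq,
    Kernel.snd_prod]

lemma comap_last_comp (κ : Kernel M.K S) (π : M.Policy) (ν : ProbabilityMeasure S) (t : ℕ) :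
    κ.comap (fun x : (_i : Finset.Iic t) → M.K => x ⟨t, Finset.mem_Iic.2 le_rfl⟩)
        (measurable_pi_apply _) ∘ₘ
      (M.trajLaw π ν).map (Preorder.frestrictLe (π := fun _ => M.K) t)
      = κ ∘ₘ M.marginalLaw π ν t := by
  rw [comap_comp_measure, Measure.map_map (measurable_pi_apply _) (by fun_prop)]
  rfl

/-- The policy affects only the action at time `t + 1`; the next state depends on the history
through `(s_t, a_t)` alone. This is what makes occupation measures asymptotically invariant. -/
lemma map_marginalLaw_succ (π : M.Policy) (ν : ProbabilityMeasure S) (t : ℕ) :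
    (M.marginalLaw π ν (t + 1)).map (fun k => k.1.1) = M.Q ∘ₘ M.marginalLaw π ν t := by
  rw [← M.comap_last_comp, ← M.map_step π, ← Measure.map_comp _ _ M.measurable_fst_K, marginalLaw,
    trajLaw, map_succ_trajMeasure]

section Stationary

variable {M}

/-- The stationary policy that uses `φ` at every time. -/
noncomputable def stationaryPolicy (φ : Kernel S A) [IsMarkovKernel φ]
    (hφ : ∀ s, φ s {a | (s, a) ∈ M.K} = 1) : M.Policy where
  kernel _ := φ.comap Prod.snd measurable_snd
  isMarkovKernel _ := inferInstance
  feasible _ h := hφ h.2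

variable (φ : Kernel S A) [IsMarkovKernel φ] (hφ : ∀ s, φ s {a | (s, a) ∈ M.K} = 1)

lemma stateAction_stationaryPolicy (t : ℕ) :
    M.stateAction (stationaryPolicy φ hφ) t
      = (M.selectorKernel φ).comap Prod.snd measurable_snd := by
  ext1 h
  rw [stateAction, selectorKernel, Kernel.comapRight_apply, Kernel.comap_apply,
    Kernel.comapRight_apply, Kernel.prod_apply, Kernel.prod_apply, Kernel.deterministic_apply,
    Kernel.id_apply]
  rfl

lemma marginalLaw_stationaryPolicy_zero (ν : ProbabilityMeasure S) :
    M.marginalLaw (stationaryPolicy φ hφ) ν 0 = M.selectorKernel φ ∘ₘ (ν : Measure S) := by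
  rw [marginalLaw, trajLaw, map_zero_trajMeasure, init, stateAction_stationaryPolicy,
    comap_comp_measure, Measure.map_map measurable_snd (by fun_prop)]
  exact congrArg (fun m => M.selectorKernel φ ∘ₘ m) (Measure.map_id (μ := (ν : Measure S)))

lemma marginalLaw_stationaryPolicy_succ (ν : ProbabilityMeasure S) (t : ℕ) :
    M.marginalLaw (stationaryPolicy φ hφ) ν (t + 1) =
      M.selectorKernel φ ∘ₘ (M.Q ∘ₘ M.marginalLaw (stationaryPolicy φ hφ) ν t) := by
  rw [← M.comap_last_comp, Measure.comp_assoc, marginalLaw, trajLaw, map_succ_trajMeasure, step,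
    stateAction_stationaryPolicy, ← Kernel.comp_map _ _ measurable_snd, ← Kernel.snd_eq,
    Kernel.snd_prod]

/-- An invariant law is the law of `(s_t, a_t)` for all `t` under a stationary policy. -/
lemma exists_policy_marginalLaw_eq [StandardBorelSpace A] (π₀ : M.Policy) (m : ProbabilityMeasure M.K)
    (hm : (m : Measure M.K).map (fun k => k.1.1) = M.Q ∘ₘ (m : Measure M.K)) :
    ∃ (π : M.Policy) (ν : ProbabilityMeasure S), ∀ t, M.marginalLaw π ν t = m := by
  classical
  have hemb := MeasurableEmbedding.subtype_coe M.measurableSet_K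
  let ν : ProbabilityMeasure S := ⟨(m : Measure M.K).map (fun k => k.1.1),
    Measure.isProbabilityMeasure_map M.measurable_fst_K.aemeasurable⟩
  let m' : Measure (S × A) := (m : Measure M.K).map Subtype.val
  have hm' : IsProbabilityMeasure m' := Measure.isProbabilityMeasure_map hemb.measurable.aemeasurable
  have : Nonempty A := by
    obtain ⟨k⟩ := Measure.nonempty_of_neZero (m : Measure M.K)
    exact ⟨k.1.2⟩
  have hfst : m'.fst = ν := Measure.map_map measurable_fst hemb.measurable
  have hK : m' M.K = 1 := by
    rw [hemb.map_apply]
    simp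
  -- The conditional kernel of `m'` respects `K` only for almost every state, whereas a policy must
  -- do so everywhere. The given policy at time `0` is a feasible kernel to use on the exceptional
  -- null set.
  let φ₀ : Kernel S A := (π₀.kernel 0).comap (fun s : S => ((fun i => i.elim0 : Fin 0 → M.K), s))
    (by fun_prop)
  let G : Set S := {s | m'.condKernel s {a | (s, a) ∈ M.K} = 1}
  have hG : MeasurableSet G :=
    (Kernel.measurable_kernel_prodMk_left M.measurableSet_K) (measurableSet_singleton 1)
  let φ : Kernel S A := Kernel.piecewise hG m'.condKernel φ₀
  have hφ : ∀ s, φ s {a | (s, a) ∈ M.K} = 1 := by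
    intro s
    by_cases hs : s ∈ G
    · rw [Kernel.piecewise_apply, if_pos hs]; exact hs
    · rw [Kernel.piecewise_apply, if_neg hs]; exact π₀.feasible 0 _
  have hae : ∀ᵐ s ∂m'.fst, s ∈ G := by
    have h1 : ∀ᵐ p ∂(m'.fst ⊗ₘ m'.condKernel), p ∈ M.K := by
      rw [m'.disintegrate]
      exact (prob_compl_eq_zero_iff M.measurableSet_K).2 hK
    filter_upwards [Measure.ae_ae_of_ae_compProd h1] with s hs
    have hms : MeasurableSet {a | (s, a) ∈ M.K} := measurable_prodMk_left M.measurableSet_K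
    exact (prob_compl_eq_zero_iff hms).1 hs
  have hdis : m'.fst ⊗ₘ φ = m' := by
    rw [Measure.compProd_congr (η := m'.condKernel), m'.disintegrate]
    filter_upwards [hae] with s hs
    rw [Kernel.piecewise_apply, if_pos hs]
  -- Checked after embedding into `S × A`, where it is the disintegration of `m'`.
  have hsel : M.selectorKernel φ ∘ₘ (ν : Measure S) = m := by
    have h1 : (M.selectorKernel φ ∘ₘ (ν : Measure S)).map Subtype.val = m' := by
      rw [Measure.map_comp _ _ hemb.measurable]
      have h2 : (M.selectorKernel φ).map Subtype.val = Kernel.id ×ₖ φ := by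
        ext1 s
        rw [Kernel.map_apply _ hemb.measurable, selectorKernel, Kernel.comapRight_apply,
          Kernel.prod_apply, Kernel.id_apply, M.map_comap_K (M.dirac_prod_K s (hφ s))]
      rw [h2, ← hfst, ← Measure.compProd_eq_comp_prod, hdis]
    have h3 := congrArg (Measure.comap (Subtype.val : M.K → S × A)) h1
    rwa [hemb.comap_map, hemb.comap_map] at h3
  refine ⟨stationaryPolicy φ hφ, ν, fun t => ?_⟩
  induction t with
  | zero => rw [marginalLaw_stationaryPolicy_zero, hsel]
  | succ t ih => rw [marginalLaw_stationaryPolicy_succ, ih, ← hm]; exact hsel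

end Stationary

end MDP

/-! ### Occupation measures and long-run averages. -/

lemma coe_le_neg_coe_iff {q : ℝ} {C : ℝ≥0∞} (hq : q ≤ 0) :
    (q : EReal) ≤ -(C : EReal) ↔ C ≤ ENNReal.ofReal (-q) := by
  rw [EReal.le_neg, ← EReal.coe_neg, ← EReal.coe_ennreal_le_coe_ennreal_iff,
    EReal.coe_ennreal_ofReal, max_eq_left (neg_nonneg.2 hq)]

lemma neg_cost_eq_integral {X : Type*} [MeasurableSpace X] {f : X → ℝ} (hf : Measurable f)
    (h0 : ∀ x, f x ≤ 0) {m : Measure X} (h : cost f m < ∞) :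
    -(cost f m : EReal) = ((∫ x, f x ∂m : ℝ) : EReal) := by
  rw [integral_eq_neg_cost hf h0, EReal.coe_neg, EReal.coe_ennreal_toReal h.ne]

namespace MDP

variable {S A : Type*}
    [TopologicalSpace S] [TopologicalSpace.MetrizableSpace S] [SecondCountableTopology S]
    [MeasurableSpace S] [BorelSpace S]
    [TopologicalSpace A] [TopologicalSpace.MetrizableSpace A] [SecondCountableTopology A]
    [MeasurableSpace A] [BorelSpace A] {M : MDP S A}

/-- The expected occupation measure of the first `n + 1` periods. -/
noncomputable def occupation (π : M.Policy) (ν : ProbabilityMeasure S) (n : ℕ) :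
    ProbabilityMeasure M.K :=
  ⟨((n : ℝ≥0∞) + 1)⁻¹ • ∑ t ∈ Finset.range (n + 1), M.marginalLaw π ν t, ⟨by
    simp only [Measure.smul_apply, Measure.coe_finsetSum, Finset.sum_apply, measure_univ,
      Finset.sum_const, Finset.card_range, nsmul_eq_mul, mul_one, smul_eq_mul, Nat.cast_add,
      Nat.cast_one]
    exact ENNReal.inv_mul_cancel (by simp) (by finiteness)⟩⟩

lemma cost_occupation (f : M.K → ℝ) (π : M.Policy) (ν : ProbabilityMeasure S) (n : ℕ) :
    cost f (occupation π ν n : Measure M.K)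
      = ((n : ℝ≥0∞) + 1)⁻¹ * ∑ t ∈ Finset.range (n + 1), cost f (M.marginalLaw π ν t) := by
  simp only [occupation, ProbabilityMeasure.coe_mk, cost]
  rw [lintegral_smul_measure, lintegral_finsetSum_measure, smul_eq_mul]

lemma extExpectation_sum {f : M.K → ℝ} (hf : Measurable f) (h0 : ∀ k, f k ≤ 0)
    (π : M.Policy) (ν : ProbabilityMeasure S) (T : ℕ) :
    extExpectation (M.trajLaw π ν) (fun x => ∑ t ∈ Finset.range T, f (x t))
      = -((∑ t ∈ Finset.range T, cost f (M.marginalLaw π ν t) : ℝ≥0∞) : EReal) := by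
  have h1 : ∀ x : ℕ → M.K, ENNReal.ofReal (∑ t ∈ Finset.range T, f (x t)) = 0 := fun x =>
    ENNReal.ofReal_of_nonpos (Finset.sum_nonpos fun t _ => h0 _)
  have h2 : ∀ x : ℕ → M.K, ENNReal.ofReal (-∑ t ∈ Finset.range T, f (x t))
      = ∑ t ∈ Finset.range T, ENNReal.ofReal (-f (x t)) := fun x => by
    rw [← Finset.sum_neg_distrib, ENNReal.ofReal_sum_of_nonneg fun t _ => neg_nonneg.2 (h0 _)]
  have h3 : ∀ t, ∫⁻ x, ENNReal.ofReal (-f (x t)) ∂(M.trajLaw π ν)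
      = cost f (M.marginalLaw π ν t) := fun t => by
    rw [cost, marginalLaw, lintegral_map (f := fun k => ENNReal.ofReal (-f k)) hf.neg.ennreal_ofReal
      (measurable_pi_apply t)]
  have h4 : ∀ t, Measurable fun x : ℕ → M.K => ENNReal.ofReal (-f (x t)) := fun t =>
    (hf.comp (measurable_pi_apply t)).neg.ennreal_ofReal
  unfold extExpectation
  simp only [h1, h2, lintegral_zero]
  rw [lintegral_finsetSum _ fun t _ => h4 t]
  simp only [h3, EReal.coe_ennreal_zero, zero_sub]

lemma average_eq_liminf {f : M.K → ℝ} (hf : Measurable f) (h0 : ∀ k, f k ≤ 0)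
    (π : M.Policy) (ν : ProbabilityMeasure S) :
    M.average f π ν =
      liminf (fun n => -(cost f (occupation π ν n : Measure M.K) : EReal)) atTop := by
  unfold average
  -- Dropping `T = 0` leaves the liminf unchanged and matches `T = n + 1` with `occupation π ν n`.
  rw [← liminf_nat_add _ 1]
  refine congrArg (fun u => liminf u atTop) (funext fun n => ?_)
  have hn : (((1 : ℝ) / ((n + 1 : ℕ) : ℝ) : ℝ) : EReal) = ((((n : ℝ≥0∞) + 1)⁻¹ : ℝ≥0∞) : EReal) := by
    have h1 : ((n : ℝ≥0∞) + 1)⁻¹ = ENNReal.ofReal (1 / ((n + 1 : ℕ) : ℝ)) := by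
      rw [one_div, ENNReal.ofReal_inv_of_pos (by positivity), ENNReal.ofReal_natCast]
      push_cast
      rfl
    rw [h1, EReal.coe_ennreal_ofReal, max_eq_left (by positivity)]
  rw [extExpectation_sum hf h0, cost_occupation, hn, EReal.coe_ennreal_mul, mul_neg]

lemma average_of_marginalLaw_eq {f : M.K → ℝ} (hf : Measurable f) (h0 : ∀ k, f k ≤ 0)
    {π : M.Policy} {ν : ProbabilityMeasure S} {m : ProbabilityMeasure M.K}
    (h : ∀ t, M.marginalLaw π ν t = m) : M.average f π ν = -(cost f (m : Measure M.K) : EReal) := by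
  have hocc : ∀ n, cost f (occupation π ν n : Measure M.K) = cost f (m : Measure M.K) := fun n => by
    rw [cost_occupation]
    simp only [h, Finset.sum_const, Finset.card_range, nsmul_eq_mul]
    rw [← mul_assoc]
    push_cast
    rw [ENNReal.inv_mul_cancel (by simp) (by finiteness), one_mul]
  rw [average_eq_liminf hf h0]
  simp only [hocc, liminf_const]

lemma eventually_cost_le {f : M.K → ℝ} (hf : Measurable f) (h0 : ∀ k, f k ≤ 0)
    {π : M.Policy} {ν : ProbabilityMeasure S} {q : ℝ} (hq : (q : EReal) < M.average f π ν) :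
    q ≤ 0 ∧ ∀ᶠ n in atTop, cost f (occupation π ν n : Measure M.K) ≤ ENNReal.ofReal (-q) := by
  rw [average_eq_liminf hf h0] at hq
  have hev := eventually_lt_of_lt_liminf hq
  have hq0 : q ≤ 0 := by
    obtain ⟨n, hn⟩ := hev.exists
    have h1 : -(cost f (occupation π ν n : Measure M.K) : EReal) ≤ 0 := by
      rw [EReal.neg_le, neg_zero]
      exact EReal.coe_ennreal_nonneg _
    exact_mod_cast (hn.trans_le h1).le
  exact ⟨hq0, hev.mono fun n hn => (coe_le_neg_coe_iff hq0).1 hn.le⟩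

/-- Any real `q` below the liminf eventually bounds the costs by `-q`; sublevel sets of the cost are
closed, so the bound survives in the limit. -/
lemma average_le_of_limit {f : M.K → ℝ} (hf : UpperSemicontinuous f) (h0 : ∀ k, f k ≤ 0)
    {π : M.Policy} {ν : ProbabilityMeasure S} {m : ProbabilityMeasure M.K} {U : Ultrafilter ℕ}
    (hU : (U : Filter ℕ) ≤ atTop) (hm : Tendsto (occupation π ν) U (𝓝 m)) :
    M.average f π ν ≤ -(cost f (m : Measure M.K) : EReal) := by
  refine le_of_forall_lt_imp_le_of_dense fun c hc => ?_
  obtain ⟨q, hcq, hq⟩ := EReal.lt_iff_exists_real_btwn.1 hc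
  obtain ⟨hq0, hev⟩ := eventually_cost_le hf.measurable h0 hq
  have hclosed := lowerSemicontinuous_iff_isClosed_preimage.1 (lowerSemicontinuous_cost hf h0)
    (ENNReal.ofReal (-q))
  exact hcq.le.trans ((coe_le_neg_coe_iff hq0).2 (hclosed.mem_of_tendsto hm (hU hev)))

/-- By `map_marginalLaw_succ` the sum over time telescopes, leaving two boundary terms of size at
most `‖h‖`. -/
lemma integral_L0Adj_occupation (h : S →ᵇ ℝ) (π : M.Policy) (ν : ProbabilityMeasure S) (n : ℕ) :
    |∫ k, M.L0Adj h k ∂(occupation π ν n : Measure M.K)| ≤ 2 * ‖h‖ * (1 / ((n : ℝ) + 1)) := by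
  have hprob : ∀ t, IsProbabilityMeasure ((M.marginalLaw π ν t).map fun k : M.K => k.1.1) :=
    fun t => Measure.isProbabilityMeasure_map M.measurable_fst_K.aemeasurable
  have hL : ∀ t, Integrable (M.L0Adj h) (M.marginalLaw π ν t) ∧
      ∫ k, M.L0Adj h k ∂(M.marginalLaw π ν t)
        = ∫ s, h s ∂((M.marginalLaw π ν t).map fun k : M.K => k.1.1)
          - ∫ s, h s ∂((M.marginalLaw π ν (t + 1)).map fun k : M.K => k.1.1) := fun t => by
    rw [map_marginalLaw_succ]
    exact M.integrable_and_integral_L0Adj (h.integrable _) (h.integrable _)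
  have hbound : ∀ t, |∫ s, h s ∂((M.marginalLaw π ν t).map fun k : M.K => k.1.1)| ≤ ‖h‖ :=
    fun t => by
      refine (norm_integral_le_of_norm_le_const (ae_of_all _ h.norm_coe_le_norm)).trans ?_
      simp
  have hsum : ∫ k, M.L0Adj h k ∂(occupation π ν n : Measure M.K) = (1 / ((n : ℝ) + 1)) *
      (∫ s, h s ∂((M.marginalLaw π ν 0).map fun k : M.K => k.1.1)
        - ∫ s, h s ∂((M.marginalLaw π ν (n + 1)).map fun k : M.K => k.1.1)) := by
    simp only [occupation, ProbabilityMeasure.coe_mk]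
    rw [integral_smul_measure, integral_finsetSum_measure fun t _ => (hL t).1]
    simp only [fun t => (hL t).2]
    rw [Finset.sum_range_sub', smul_eq_mul, ENNReal.toReal_inv]
    congr 1
    rw [one_div, ENNReal.toReal_add (by simp) (by simp)]
    simp
  rw [hsum, abs_mul, abs_of_nonneg (by positivity : (0 : ℝ) ≤ 1 / ((n : ℝ) + 1)), mul_comm]
  refine mul_le_mul_of_nonneg_right ?_ (by positivity)
  exact (abs_sub _ _).trans (by linarith [hbound 0, hbound (n + 1)])

variable {z : M.K → ℝ} {a b : ℝ} {y : Set.Icc a b → ℝ}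

/-- Limits of occupation measures of a feasible pair are feasible for the moment problem. -/
lemma exists_momentFeasible_of_mem_Feasible (hr : ∀ k, M.r k ≤ 0)
    (hrc : ∀ ε : ℝ, 0 ≤ ε → IsCompact {k : M.K | -ε ≤ M.r k})
    (hzb : ∃ C : ℝ, ∀ k, |z k| ≤ C) (hz : UpperSemicontinuous z)
    (hQ : ∀ g : S →ᵇ ℝ, Continuous fun k : M.K => ∫ ξ, g ξ ∂(M.Q k))
    {p : M.Policy × ProbabilityMeasure S} (hp : p ∈ M.Feasible z a b y) :
    ∃ m, MomentFeasible M.r (M.constraintFn z a b y) m ∧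
      M.R p.1 p.2 ≤ ((∫ k, M.r k ∂(m : Measure M.K) : ℝ) : EReal) := by
  obtain ⟨π, ν⟩ := p
  obtain ⟨hR, hZ⟩ := hp
  dsimp only at *
  have husc := upperSemicontinuous_of_isCompact_levels hr hrc
  -- The condition `R > -∞` is what keeps the occupation measures in a compact set eventually.
  obtain ⟨q, -, hq⟩ := EReal.lt_iff_exists_real_btwn.1 hR
  obtain ⟨-, hev⟩ := eventually_cost_le husc.measurable hr hq
  let U : Ultrafilter ℕ := Ultrafilter.of atTop
  have hU : (U : Filter ℕ) ≤ atTop := Ultrafilter.of_le _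
  obtain ⟨m, hmC, hm⟩ := (isCompact_cost_le hr hrc (ENNReal.ofReal_ne_top (r := -q))).ultrafilter_le_nhds
    (U.map (occupation π ν)) (by
      rw [le_principal_iff]
      exact hU hev)
  have hm : Tendsto (occupation π ν) U (𝓝 m) := hm
  have hcost : cost M.r (m : Measure M.K) < ∞ := lt_of_le_of_lt hmC ENNReal.ofReal_lt_top
  refine ⟨m, (momentFeasible_iff hz hzb m).2
    ⟨hcost, (integral_L0Adj_nonneg_iff _).1 fun h => ?_, fun η => ?_⟩, ?_⟩
  · have hlim : Tendsto (fun n => ∫ k, M.L0Adj h k ∂(occupation π ν n : Measure M.K)) U (𝓝 0) := by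
      refine Tendsto.mono_left ?_ hU
      refine squeeze_zero_norm (integral_L0Adj_occupation h π ν) ?_
      simpa using (tendsto_one_div_add_atTop_nhds_zero_nat (𝕜 := ℝ)).const_mul (2 * ‖h‖)
    have hgusc := upperSemicontinuous_constraintFn (z := z) (y := y) hQ hz (Sum.inl h)
    obtain ⟨B, hB⟩ := exists_bound_constraintFn (y := y) hzb (Sum.inl h)
    -- Upper semicontinuity of the integral suffices: a negative value at `m` would keep nearby
    -- integrals below some `c < 0`, but they tend to `0`.
    by_contra! hneg
    obtain ⟨c, hc1, hc2⟩ := exists_between hneg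
    have h1 := hm.eventually (upperSemicontinuous_integral hgusc hB m c hc1)
    have h2 := hlim.eventually (lt_mem_nhds hc2)
    obtain ⟨n, hn1, hn2⟩ := (h1.and h2).exists
    exact lt_asymm hn1 hn2
  · have h1 := (hZ η).trans (average_le_of_limit (upperSemicontinuous_minusPart_sub hz η)
      (fun k => minusPart_nonpos _) hU hm)
    rw [neg_cost_eq_integral (upperSemicontinuous_minusPart_sub hz η).measurable
      (fun k => minusPart_nonpos _)
      (cost_lt_top_of_integrable (integrable_minusPart_sub hz hzb η _))] at h1
    exact_mod_cast h1
  · rw [← neg_cost_eq_integral M.measurable_r hr hcost]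
    exact average_le_of_limit husc hr hU hm

/-- A law feasible for the moment problem is realized by a stationary policy. -/
lemma exists_mem_Feasible_of_momentFeasible [StandardBorelSpace A] (hr : ∀ k, M.r k ≤ 0)
    (hzb : ∃ C : ℝ, ∀ k, |z k| ≤ C) (hz : UpperSemicontinuous z) (π₀ : M.Policy)
    {m : ProbabilityMeasure M.K} (hm : MomentFeasible M.r (M.constraintFn z a b y) m) :
    ∃ p ∈ M.Feasible z a b y,
      M.R p.1 p.2 = ((∫ k, M.r k ∂(m : Measure M.K) : ℝ) : EReal) := by
  obtain ⟨hc, hinv, hy⟩ := (momentFeasible_iff hz hzb m).1 hm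
  obtain ⟨π, ν, hlaw⟩ := exists_policy_marginalLaw_eq π₀ m hinv
  have hR : M.R π ν = ((∫ k, M.r k ∂(m : Measure M.K) : ℝ) : EReal) := by
    rw [← neg_cost_eq_integral M.measurable_r hr hc]
    exact average_of_marginalLaw_eq M.measurable_r hr hlaw
  refine ⟨(π, ν), ⟨hR ▸ EReal.bot_lt_coe _, fun η => ?_⟩, hR⟩
  have hmeas := (upperSemicontinuous_minusPart_sub hz η).measurable
  rw [Z, average_of_marginalLaw_eq hmeas (fun k => minusPart_nonpos _) hlaw,
    neg_cost_eq_integral hmeas (fun k => minusPart_nonpos _)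
      (cost_lt_top_of_integrable (integrable_minusPart_sub hz hzb η _))]
  exact_mod_cast hy η

end MDP

end DominanceMDP

/-! ### The main theorem. -/

theorem mainTheorem2
    {S A Ω : Type*}
    [TopologicalSpace S] [TopologicalSpace.MetrizableSpace S] [SecondCountableTopology S]
    [MeasurableSpace S] [BorelSpace S] [StandardBorelSpace S]
    [TopologicalSpace A] [TopologicalSpace.MetrizableSpace A] [SecondCountableTopology A]
    [MeasurableSpace A] [BorelSpace A] [StandardBorelSpace A]
    (M : DominanceMDP.MDP S A) (z : M.K → ℝ) (a b : ℝ)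
    [MeasurableSpace Ω] (P : Measure Ω) [IsProbabilityMeasure P] (Y : Ω → ℝ)
    (hY : AEMeasurable Y P) (hYab : ∀ᵐ ω ∂P, Y ω ∈ Set.Icc a b)
    -- the dominance-constrained problem is consistent
    (hΔ : (M.Feasible z a b (DominanceMDP.benchmark P Y a b)).Nonempty)
    -- the reward is nonpositive and has compact upper level sets
    (hr : ∀ k, M.r k ≤ 0)
    (hrc : ∀ ε : ℝ, 0 ≤ ε → IsCompact {k : M.K | -ε ≤ M.r k})
    -- `z` is bounded and upper semicontinuous
    (hzb : ∃ C : ℝ, ∀ k, |z k| ≤ C) (hzu : UpperSemicontinuous z)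
    -- the transition law is weakly continuous
    (hQ : ∀ g : BoundedContinuousFunction S ℝ, Continuous fun k : M.K => ∫ ξ, g ξ ∂(M.Q k))
    -- growth conditions with respect to the weights
    (hzw : ∀ η ∈ Set.Icc a b, (fun k => DominanceMDP.minusPart (z k - η)) ∈ DominanceMDP.weightedFunctions M.w)
    (hwi : ∀ k : M.K, Integrable M.wHat (M.Q k))
    (hwQ : (fun k : M.K => ∫ ξ, M.wHat ξ ∂(M.Q k)) ∈ DominanceMDP.weightedFunctions M.w) :
    ∃ ρ : ℝ,
      IsGreatest ((fun p => M.R p.1 p.2) '' M.Feasible z a b (DominanceMDP.benchmark P Y a b)) (ρ : EReal) ∧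
      IsGreatest ((fun μ => DominanceMDP.pairing μ M.r) '' M.primalFeasible z a b (DominanceMDP.benchmark P Y a b)) ρ ∧
      IsGLB ((fun d => d.2.1 - DominanceMDP.pairing d.2.2 (DominanceMDP.benchmark P Y a b)) '' M.dualFeasible z a b) ρ := by
  have hymcont := DominanceMDP.continuous_benchmark P Y a b hY hYab
  obtain ⟨p₀, hp₀⟩ := hΔ
  have husc := DominanceMDP.upperSemicontinuous_of_isCompact_levels hr hrc
  obtain ⟨m₀, hm₀, -⟩ :=
    DominanceMDP.MDP.exists_momentFeasible_of_mem_Feasible hr hrc hzb hzu hQ hp₀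
  obtain ⟨m, hm, hmin⟩ := DominanceMDP.exists_momentFeasible_min_cost hr hrc
    (DominanceMDP.MDP.upperSemicontinuous_constraintFn hQ hzu)
    (DominanceMDP.MDP.exists_bound_constraintFn hzb) ⟨m₀, hm₀⟩
  have hmax : ∀ m', DominanceMDP.MomentFeasible M.r
      (M.constraintFn z a b (DominanceMDP.benchmark P Y a b)) m' →
      ∫ k, M.r k ∂(m' : Measure M.K) ≤ ∫ k, M.r k ∂(m : Measure M.K) := fun m' hm' => by
    rw [DominanceMDP.integral_eq_neg_cost M.measurable_r hr,
      DominanceMDP.integral_eq_neg_cost M.measurable_r hr]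
    exact neg_le_neg (ENNReal.toReal_mono hm'.1.ne (hmin m' hm'))
  refine ⟨∫ k, M.r k ∂(m : Measure M.K), ⟨?_, ?_⟩, ⟨?_, ?_⟩, ?_, ?_⟩
  · exact DominanceMDP.MDP.exists_mem_Feasible_of_momentFeasible hr hzb hzu p₀.1 hm
  · rintro _ ⟨p, hp, rfl⟩
    obtain ⟨m', hm', hle⟩ :=
      DominanceMDP.MDP.exists_momentFeasible_of_mem_Feasible hr hrc hzb hzu hQ hp
    exact hle.trans (EReal.coe_le_coe_iff.2 (hmax m' hm'))
  · exact ⟨_, (DominanceMDP.MDP.mem_primalFeasible_iff hr hzu hzb _).2 ⟨m, hm, rfl⟩,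
      DominanceMDP.pairing_toSignedMeasure _ _⟩
  · rintro _ ⟨μ, hμ, rfl⟩
    obtain ⟨m', hm', rfl⟩ := (DominanceMDP.MDP.mem_primalFeasible_iff hr hzu hzb _).1 hμ
    exact (DominanceMDP.pairing_toSignedMeasure _ _).le.trans (hmax m' hm')
  · rintro _ ⟨d, hd, rfl⟩
    exact DominanceMDP.MDP.integral_le_of_dualFeasible hr hzu hzb hymcont hm hd
  · intro l hl
    -- The dual infimum need not be attained; each `c` above the optimal value is itself a dual
    -- value.
    refine le_of_forall_gt_imp_ge_of_dense fun c hc => ?_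
    obtain ⟨d, hd, hval⟩ := DominanceMDP.MDP.exists_dualFeasible_le hr hrc hzb hzu hQ ⟨m, hm⟩
      fun m' hm' => (hmax m' hm').trans_lt hc
    exact hval ▸ hl ⟨d, hd, rfl⟩
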